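/- Let $K$ be a compact Lie group with Lie algebra $\mathfrak k$, let $\langle\!\langle\cdot,\cdot\rangle\!\rangle$ be an $\mathrm{Ad}$-invariant inner product on $\mathfrak k$, let $(M,g)$ be a smooth Riemannian manifold, and let $p:P\to M$ be a smooth principal $K$-bundle (with right action $R_k(y)=yk$) endowed with a connection $A$ with connection form $\omega_A\in A^1(P,\mathfrak k)$. Let $$g_A=p^*g+\langle\!\langle\omega_A,\omega_A\rangle\!\rangle$$ be the connection metric on $P$. A smooth vector field $Y$ on a Riemannian manifold $(N,h)$ is called Killing if $L_Yh=0$, i.e. $Y\,h(Y_1,Y_2)=h([Y,Y_1],Y_2)+h(Y_1,[Y,Y_2])$ for all smooth vector fields $Y_1,Y_2$; let $\mathfrak i(M)$ and $\mathfrak i(P)$ be the Lie algebras of Killing fields of $(M,g)$ and $(P,g_A)$. A vector field $Y$ on $P$ is $K$-invariant if $(R_k)_*Y=Y$ for all $k\in K$. For a vector field $X$ on $M$ let $\tilde X$ be its horizontal lift: $\omega_A(\tilde X)=0$ and $p_*\tilde X_y=X_{p(y)}$. Identify the space $A^0(\mathrm{ad}(P))$ of smooth sections of the adjoint bundle $\mathrm{ad}(P)=P\times_{\mathrm{ad}}\mathfrak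 k$ with the space of smooth maps $\nu:P\to\mathfrak k$ satisfying $\nu(yk)=\mathrm{Ad}_{k^{-1}}\nu(y)$, and let $\xi^\nu$ be the vertical vector field $\xi^\nu_y=\frac{d}{dt}\big|_{t=0}\,y\exp(t\nu(y))$. Under this identification the induced covariant derivative is $\nabla^A_Z\nu=d\nu(\tilde Z)$ and the curvature $F_A\in A^2(\mathrm{ad}(P))$ is $F_A(X,Z)=(d\omega_A+\tfrac12[\omega_A\wedge\omega_A])(\tilde X,\tilde Z)$, where $d\omega_A(U,V)=U\omega_A(V)-V\omega_A(U)-\omega_A([U,V])$ and $\tfrac12[\omega_A\wedge\omega_A](U,V)=[\omega_A(U),\omega_A(V)]$. Then the Killing fields of $(P,g_A)$ form a Lie subalgebra $\mathfrak i(P)$ of the Lie algebra of smooth vector fields on $P$, the set $\mathfrak i_K(P)$ of $K$-invariant Killing fields of $(P,g_A)$ is a Lie subalgebra of $\mathfrak i(P)$, and $$\mathfrak i_K(P)=\{\tilde X+\xi^\nu \;:\; X\in\mathfrak i(M),\ \nu\in A^0(\mathrm{ad}(P)),\ \iota_XF_A=-\nabla^A\nu\}.$$ -/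

import Mathlib

open scoped Manifold ContDiff

noncomputable section

namespace ConnectionMetric

/-! ### Smooth vector fields and their Lie algebra -/

section VectorFields

variable (E : Type*) [NormedAddCommGroup E] [NormedSpace ℝ E]
  (M : Type*) [TopologicalSpace M] [ChartedSpace E M] [IsManifold 𝓘(ℝ, E) ∞ M]

/-- The space `𝒳(M)` of smooth vector fields on a smooth manifold `M` modelled on `E`. -/
abbrev SmoothVF : Type _ :=
  ContMDiffSection 𝓘(ℝ, E) E ∞ (fun x : M => TangentSpace 𝓘(ℝ, E) x)

variable {E M}
variable [FiniteDimensional ℝ E]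

/-- The Lie bracket of two smooth vector fields is smooth. -/
theorem contMDiff_bracket (X Y : SmoothVF E M) :
    ContMDiff 𝓘(ℝ, E) (𝓘(ℝ, E).prod 𝓘(ℝ, E)) ∞
      (fun x => (Bundle.TotalSpace.mk' E x (VectorField.mlieBracket 𝓘(ℝ, E) X Y x) :
        TangentBundle 𝓘(ℝ, E) M)) := by
  have : CompleteSpace E := FiniteDimensional.complete ℝ E
  have : IsManifold 𝓘(ℝ, E) (((⊤ : ℕ∞) : WithTop ℕ∞) + 1) M :=
    inferInstanceAs (IsManifold 𝓘(ℝ, E) ∞ M)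
  have : IsManifold 𝓘(ℝ, E) (minSmoothness ℝ 2) M := by
    rw [minSmoothness_of_isRCLikeNormedField]
    infer_instance
  have : IsManifold 𝓘(ℝ, E) (minSmoothness ℝ 3) M := by
    rw [minSmoothness_of_isRCLikeNormedField]
    infer_instance
  exact ContDiff.mlieBracket_vectorField (m := ⊤) (n := ⊤) X.contMDiff Y.contMDiff
    (by simp)

/-- The Lie bracket of smooth vector fields. -/
instance : Bracket (SmoothVF E M) (SmoothVF E M) where
  bracket X Y := ⟨VectorField.mlieBracket 𝓘(ℝ, E) X Y, contMDiff_bracket X Y⟩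

theorem bracket_apply (X Y : SmoothVF E M) (x : M) :
    ⁅X, Y⁆ x = VectorField.mlieBracket 𝓘(ℝ, E) X Y x := rfl

instance : LieRing (SmoothVF E M) where
  add_lie X Y Z := by
    ext x
    exact VectorField.mlieBracket_add_left X.mdifferentiableAt Y.mdifferentiableAt
  lie_add X Y Z := by
    ext x
    exact VectorField.mlieBracket_add_right Y.mdifferentiableAt Z.mdifferentiableAt
  lie_self X := by
    ext x
    simp [bracket_apply]
  leibniz_lie X Y Z := by
    have : CompleteSpace E := FiniteDimensional.complete ℝ E
    have : IsManifold 𝓘(ℝ, E) (minSmoothness ℝ 3) M := by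
      rw [minSmoothness_of_isRCLikeNormedField]
      infer_instance
    have h : ∀ W : SmoothVF E M, ContMDiff 𝓘(ℝ, E) (𝓘(ℝ, E).prod 𝓘(ℝ, E)) (minSmoothness ℝ 2)
        (fun x => (Bundle.TotalSpace.mk' E x (W x) : TangentBundle 𝓘(ℝ, E) M)) := by
      intro W
      rw [minSmoothness_of_isRCLikeNormedField]
      exact W.contMDiff.of_le (ENat.LEInfty.out)
    ext x
    exact VectorField.leibniz_identity_mlieBracket_apply (h X x) (h Y x) (h Z x)

instance : LieAlgebra ℝ (SmoothVF E M) where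
  lie_smul c X Y := by
    ext x
    exact VectorField.mlieBracket_const_smul_right Y.mdifferentiableAt

/-- A vector field `X` is Killing for a `(0,2)`-tensor `h` if `L_X h = 0`, that is
`X h(X₁, X₂) = h([X, X₁], X₂) + h(X₁, [X, X₂])` for all smooth vector fields `X₁`, `X₂`. -/
def IsKilling (h : ∀ x : M, TangentSpace 𝓘(ℝ, E) x → TangentSpace 𝓘(ℝ, E) x → ℝ)
    (X : SmoothVF E M) : Prop :=
  ∀ (X₁ X₂ : SmoothVF E M) (x : M),
    mfderiv 𝓘(ℝ, E) 𝓘(ℝ, ℝ) (fun z => h z (X₁ z) (X₂ z)) x (X x) =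
      h x (VectorField.mlieBracket 𝓘(ℝ, E) X X₁ x) (X₂ x) +
        h x (X₁ x) (VectorField.mlieBracket 𝓘(ℝ, E) X X₂ x)

end VectorFields

/-! ### Principal bundles, connections and the adjoint bundle -/

variable {EM : Type*} [NormedAddCommGroup EM] [NormedSpace ℝ EM]
  {M : Type*} [TopologicalSpace M] [ChartedSpace EM M]
  {EK : Type*} [NormedAddCommGroup EK] [NormedSpace ℝ EK]
  {K : Type*} [TopologicalSpace K] [ChartedSpace EK K] [Group K]
  {EP : Type*} [NormedAddCommGroup EP] [NormedSpace ℝ EP]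
  {P : Type*} [TopologicalSpace P] [ChartedSpace EP P] [MulAction Kᵐᵒᵖ P]

/-- `p : P → M` is a smooth principal `K`-bundle for the right action
`(y, k) ↦ y k = MulOpposite.op k • y` of `K` on `P`. -/
structure IsPrincipalBundle (EM EK EP : Type*)
    [NormedAddCommGroup EM] [NormedSpace ℝ EM] [NormedAddCommGroup EK] [NormedSpace ℝ EK]
    [NormedAddCommGroup EP] [NormedSpace ℝ EP]
    {M : Type*} [TopologicalSpace M] [ChartedSpace EM M]
    (K : Type*) [TopologicalSpace K] [ChartedSpace EK K] [Group K]
    {P : Type*} [TopologicalSpace P] [ChartedSpace EP P] [MulAction Kᵐᵒᵖ P]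
    (p : P → M) : Prop where
  contMDiff_proj : ContMDiff 𝓘(ℝ, EP) 𝓘(ℝ, EM) ∞ p
  contMDiff_act : ContMDiff (𝓘(ℝ, EP).prod 𝓘(ℝ, EK)) 𝓘(ℝ, EP) ∞
    (fun q : P × K => MulOpposite.op q.2 • q.1)
  proj_act : ∀ (y : P) (k : K), p (MulOpposite.op k • y) = p y
  /-- Around every point of `M` there is a `K`-equivariant local trivialization
  `p⁻¹(U) ≃ U × K` over `U` which is a diffeomorphism. -/
  locally_trivial : ∀ x : M, ∃ (U : Set M) (e : OpenPartialHomeomorph P (M × K)),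
    IsOpen U ∧ x ∈ U ∧ e.source = p ⁻¹' U ∧ e.target = U ×ˢ Set.univ ∧
    ContMDiffOn 𝓘(ℝ, EP) (𝓘(ℝ, EM).prod 𝓘(ℝ, EK)) ∞ e e.source ∧
    ContMDiffOn (𝓘(ℝ, EM).prod 𝓘(ℝ, EK)) 𝓘(ℝ, EP) ∞ e.symm e.target ∧
    (∀ y ∈ e.source, (e y).1 = p y) ∧
    (∀ y ∈ e.source, ∀ k : K, e (MulOpposite.op k • y) = ((e y).1, (e y).2 * k))

/-! The Lie algebra of `K` is `𝔨 = T₁K = GroupLieAlgebra 𝓘(ℝ, EK) K`, whose underlying vector space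
is by definition the model space `EK`. Elements of `𝔨` are written as elements of `EK`, so that
`𝔨`-valued functions can be differentiated; the bracket and the adjoint action are those of `T₁K`. -/

/-- The Lie bracket of `𝔨 = T₁K`. -/
def lieBr (K : Type*) [TopologicalSpace K] [ChartedSpace EK K] [Group K] (a b : EK) : EK :=
  Bracket.bracket (L := GroupLieAlgebra 𝓘(ℝ, EK) K) (M := GroupLieAlgebra 𝓘(ℝ, EK) K) a b

/-- The adjoint representation of `K` on `𝔨`: the derivative at `1` of `g ↦ k g k⁻¹`. -/
def Ad (k : K) : EK →L[ℝ] EK :=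
  mfderiv 𝓘(ℝ, EK) 𝓘(ℝ, EK) (fun g : K => k * g * k⁻¹) 1

/-- The map `a ↦ a^#_y` from `𝔨` to `T_yP`, where `a^#` is the fundamental field of `a`: the
derivative at `1` of `k ↦ y k`. -/
def fundamental (K : Type*) [TopologicalSpace K] [ChartedSpace EK K] [Group K]
    [MulAction Kᵐᵒᵖ P] (y : P) : EK →L[ℝ] TangentSpace 𝓘(ℝ, EP) y :=
  show EK →L[ℝ] EP from
    mfderiv 𝓘(ℝ, EK) 𝓘(ℝ, EP) (fun k : K => MulOpposite.op k • y) 1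

/-- A connection on a principal `K`-bundle `P`, given by its connection `1`-form `ω`. The
horizontal distribution is `y ↦ ker ω_y`. -/
structure Connection (EK EP : Type*)
    [NormedAddCommGroup EK] [NormedSpace ℝ EK] [NormedAddCommGroup EP] [NormedSpace ℝ EP]
    (K : Type*) [TopologicalSpace K] [ChartedSpace EK K] [Group K]
    (P : Type*) [TopologicalSpace P] [ChartedSpace EP P] [IsManifold 𝓘(ℝ, EP) ∞ P]
    [MulAction Kᵐᵒᵖ P] where
  form : ∀ y : P, TangentSpace 𝓘(ℝ, EP) y →L[ℝ] EK
  contMDiff_form : ContMDiff 𝓘(ℝ, EP) (𝓘(ℝ, EP).prod 𝓘(ℝ, EP →L[ℝ] EK)) ∞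
    (fun y => Bundle.TotalSpace.mk' (EP →L[ℝ] EK)
      (E := fun y : P => TangentSpace 𝓘(ℝ, EP) y →L[ℝ] Bundle.Trivial P EK y) y (form y))
  form_fundamental : ∀ (y : P) (a : EK), form y (fundamental K y a) = a
  form_act : ∀ (y : P) (k : K) (v : TangentSpace 𝓘(ℝ, EP) y),
    form (MulOpposite.op k • y)
      (mfderiv 𝓘(ℝ, EP) 𝓘(ℝ, EP) (fun z : P => MulOpposite.op k • z) y v) =
        Ad k⁻¹ (form y v)

/-- The space `A⁰(ad P)` of smooth sections of the adjoint bundle `ad(P) = P ×_ad 𝔨`, identified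
with the space of smooth maps `ν : P → 𝔨` such that `ν(yk) = Ad_{k⁻¹} ν(y)`; the section of `ad(P)`
corresponding to `ν` is `p(y) ↦ [y, ν(y)]`. -/
structure AdSection (EK EP : Type*)
    [NormedAddCommGroup EK] [NormedSpace ℝ EK] [NormedAddCommGroup EP] [NormedSpace ℝ EP]
    (K : Type*) [TopologicalSpace K] [ChartedSpace EK K] [Group K]
    (P : Type*) [TopologicalSpace P] [ChartedSpace EP P] [MulAction Kᵐᵒᵖ P] where
  toFun : P → EK
  contMDiff_toFun : ContMDiff 𝓘(ℝ, EP) 𝓘(ℝ, EK) ∞ toFun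
  equivariant : ∀ (y : P) (k : K), toFun (MulOpposite.op k • y) = Ad k⁻¹ (toFun y)

/-- The vertical vector field `ξ^ν` on `P` associated with `ν ∈ A⁰(ad P)`. -/
def AdSection.verticalField (ν : AdSection EK EP K P) (y : P) : TangentSpace 𝓘(ℝ, EP) y :=
  fundamental K y (ν.toFun y)

/-- An `Ad`-invariant inner product on the Lie algebra `𝔨`. -/
structure AdInvariantInner (EK : Type*) [NormedAddCommGroup EK] [NormedSpace ℝ EK]
    (K : Type*) [TopologicalSpace K] [ChartedSpace EK K] [Group K] where
  form : LinearMap.BilinForm ℝ EK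
  symm : ∀ a b, form a b = form b a
  pos : ∀ a, a ≠ 0 → 0 < form a a
  invariant : ∀ (k : K) (a b), form (Ad k a) (Ad k b) = form a b

/-- A vector field `Y` on `P` is `K`-invariant if `(R_k)_* Y = Y` for all `k ∈ K`, where
`R_k(y) = yk`. -/
def IsInvariant (K : Type*) [Group K] [MulAction Kᵐᵒᵖ P] [IsManifold 𝓘(ℝ, EP) ∞ P]
    (Y : SmoothVF EP P) : Prop :=
  ∀ (k : K) (y : P),
    mfderiv 𝓘(ℝ, EP) 𝓘(ℝ, EP) (fun z : P => MulOpposite.op k • z) y (Y y) =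
      Y (MulOpposite.op k • y)

namespace Connection

variable [IsManifold 𝓘(ℝ, EP) ∞ P] (A : Connection EK EP K P) (p : P → M)

/-- The horizontal lift of a vector field `X` on `M`: its value at `y` is the unique tangent vector
`u` with `p_* u = X_{p(y)}` and `ω(u) = 0`, obtained by inverting the isomorphism
`(p_*, ω) : T_yP → T_{p(y)}M × 𝔨`. -/
def lift (X : ∀ x : M, TangentSpace 𝓘(ℝ, EM) x) (y : P) : TangentSpace 𝓘(ℝ, EP) y :=
  ((mfderiv 𝓘(ℝ, EP) 𝓘(ℝ, EM) p y).prod (A.form y)).inverse (X (p y), 0)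

/-- The derivative at `y` of a `𝔨`-valued function on `P` in the direction `v`. -/
def dirDeriv (f : P → EK) (y : P) (v : TangentSpace 𝓘(ℝ, EP) y) : EK :=
  mfderiv 𝓘(ℝ, EP) 𝓘(ℝ, EK) f y v

/-- The value at `y` of `dω(U, V) + [ω(U), ω(V)]`, where
`dω(U, V) = U(ω(V)) - V(ω(U)) - ω([U, V])`. -/
def curvatureForm (U V : ∀ y : P, TangentSpace 𝓘(ℝ, EP) y) (y : P) : EK :=
  dirDeriv (fun z => A.form z (V z)) y (U y) - dirDeriv (fun z => A.form z (U z)) y (V y) -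
    A.form y (VectorField.mlieBracket 𝓘(ℝ, EP) U V y) +
    lieBr K (A.form y (U y)) (A.form y (V y))

/-- The curvature `F_A(X, Z) ∈ A⁰(ad P)`, as an equivariant function `P → 𝔨`. -/
def curvature (X Z : ∀ x : M, TangentSpace 𝓘(ℝ, EM) x) (y : P) : EK :=
  A.curvatureForm (A.lift p X) (A.lift p Z) y

/-- The covariant derivative `∇^A_Z ν ∈ A⁰(ad P)`, as the equivariant function `dν(Z̃)` on `P`. -/
def covDeriv (Z : ∀ x : M, TangentSpace 𝓘(ℝ, EM) x) (ν : AdSection EK EP K P) (y : P) : EK :=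
  dirDeriv ν.toFun y (A.lift p Z y)

/-- The generalized moment map equation `ι_X F_A = -∇^A ν` in `A¹(ad P)`. -/
def MomentMapEq [IsManifold 𝓘(ℝ, EM) ∞ M] (X : SmoothVF EM M) (ν : AdSection EK EP K P) : Prop :=
  ∀ (Z : SmoothVF EM M) (y : P), A.curvature p X Z y = -A.covDeriv p Z ν y

/-- The connection metric `g_A = p^* g + ⟪ω, ω⟫` on `P`. -/
def metric [IsManifold 𝓘(ℝ, EM) ∞ M] (B : AdInvariantInner EK K)
    (g : Bundle.ContMDiffRiemannianMetric 𝓘(ℝ, EM) ∞ EM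
      (fun x : M => TangentSpace 𝓘(ℝ, EM) x))
    (y : P) (v w : TangentSpace 𝓘(ℝ, EP) y) : ℝ :=
  g.inner (p y) (mfderiv 𝓘(ℝ, EP) 𝓘(ℝ, EM) p y v) (mfderiv 𝓘(ℝ, EP) 𝓘(ℝ, EM) p y w) +
    B.form (A.form y v) (A.form y w)

end Connection

end ConnectionMetric

end

/-! A `K`-invariant field `Y` is projectable, hence splits as `X̃ + ξ^ν`, where `X` is its
pushforward to `M` and `ν = ω(Y)` is equivariant. Conversely every `X̃ + ξ^ν` is smooth and
invariant. What remains is to decide when `Y = X̃ + ξ^ν` is Killing.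

The Lie derivative of `g_A` along `Y` is tensorial, so it may be tested on fields `Z̃ + a^#` with `a
∈ 𝔨` constant, whose values exhaust each tangent space. On two of them `g_A` is `g(Z₁, Z₂) ∘ p +
⟪a₁, a₂⟫`, whose second term is constant. Moreover `[Y, a^#] = 0` because `Y` is invariant, while
`[Y, Z̃]` projects to `[X, Z]` and has `ω`-component `-(F_A(X, Z) + ∇_Z ν)`: the curvature comes
from `[X̃, Z̃]`, the covariant derivative from `[ξ^ν, Z̃] = -(dν(Z̃))^#`. Therefore `(L_Y g_A)(Z̃₁ +
a₁^#, Z̃₂ + a₂^#) = (L_X g)(Z₁, Z₂) ∘ p + ⟪F_A(X, Z₁) + ∇_{Z₁} ν, a₂⟫ + ⟪a₁, F_A(X, Z₂) + ∇_{Z₂}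
ν⟫`, which is `Connection.lieDerivative_metricForm`. By positivity of the inner product it vanishes
identically exactly when `X` is Killing and the moment map equation holds
(`Connection.isKilling_metric_iff`).

Killing fields are closed under brackets by the commutator formula and Jacobi, invariant fields
because brackets of related fields are related (`mfderiv_mlieBracket_of_related`). -/

noncomputable section

open Set Filter Topology Bundle

namespace ConnectionMetric

/-! ### Lie brackets as commutators of derivations, and related vector fields. -/

section Bracket

variable {E : Type*} [NormedAddCommGroup E] [NormedSpace ℝ E]
  {H : Type*} [TopologicalSpace H] {I : ModelWithCorners ℝ E H}
  {M : Type*} [TopologicalSpace M] [ChartedSpace H M]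
  {F : Type*} [NormedAddCommGroup F] [NormedSpace ℝ F]
  {E' : Type*} [NormedAddCommGroup E'] [NormedSpace ℝ E']
  {H' : Type*} [TopologicalSpace H'] {J : ModelWithCorners ℝ E' H'}
  {N : Type*} [TopologicalSpace N] [ChartedSpace H' N]

/-- For `n = ∞` the neighbourhoods attached to the successive finite orders could shrink to the
point. The bracket lemmas use `n = 2`. -/
theorem eventually_contMDiffAt {n : WithTop ℕ∞} [IsManifold I n M] [IsManifold J n N]
    {f : M → N} {x : M} (hn : n ≠ ∞)
    (hf : ContMDiffAt I J n f x) :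
    ∀ᶠ z in 𝓝 x, ContMDiffAt I J n f z := by
  obtain ⟨u, hu, h⟩ := (contMDiffAt_iff_contMDiffOn_nhds hn).1 hf
  filter_upwards [eventually_mem_nhds_iff.2 hu] with z hz
  exact h.contMDiffAt hz

/-- The chain rule for a vector-valued function. -/
theorem mvfderiv_comp_apply_vector {f : M → N} {φ : N → F} {x : M}
    (hφ : MDifferentiableAt J 𝓘(ℝ, F) φ (f x))
    (hf : MDifferentiableAt I J f x) (v : TangentSpace I x) :
    mvfderiv I (φ ∘ f) x v =
      mvfderiv J φ (f x) (mfderiv I J f x v) := by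
  have := mfderiv_comp x hφ hf
  exact congrArg (fun L : E →L[ℝ] F => L v) this

theorem mvfderiv_congr {f g : M → F} {x : M} (h : f =ᶠ[𝓝 x] g) :
    mvfderiv I f x = mvfderiv I g x := by
  have := h.mfderiv_eq (I := I) (I' := 𝓘(ℝ, F))
  ext v
  exact congrArg (fun L : E →L[ℝ] F => L v) this

variable [IsManifold I ∞ M] [IsManifold J ∞ N]

/-- The vector field `V` read in the preferred chart at `x`. -/
def chartField (V : ∀ x : M, TangentSpace I x) (x : M) : E → E :=
  VectorField.mpullbackWithin 𝓘(ℝ, E) I (extChartAt I x).symm V (range I)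

/-- A vector field on a manifold is differentiable at a point. -/
abbrev VFDiffAt (I : ModelWithCorners ℝ E H) [IsManifold I 1 M]
    (V : ∀ x : M, TangentSpace I x) (x : M) : Prop :=
  MDifferentiableAt I (I.prod 𝓘(ℝ, E))
    (fun z => (⟨z, V z⟩ : TangentBundle I M)) x

theorem chartField_self (V : ∀ x : M, TangentSpace I x) (x : M) :
    chartField V x (extChartAt I x x) = V x := by
  rw [chartField, VectorField.mpullbackWithin_apply, mfderivWithin_range_extChartAt_symm]
  have : ∀ v : E, (ContinuousLinearMap.id ℝ E).inverse v = v := by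
    intro v
    rw [ContinuousLinearMap.inverse_id]; rfl
  refine (this _).trans ?_
  rw [extChartAt_to_inv]

variable [I.Boundaryless] [J.Boundaryless]

theorem mdifferentiableAt_extChartAt_symm' {x : M} {z : E}
    (hz : z ∈ (extChartAt I x).target) :
    MDifferentiableAt 𝓘(ℝ, E) I (extChartAt I x).symm z := by
  have := mdifferentiableWithinAt_extChartAt_symm (I := I) hz
  rwa [I.range_eq_univ, mdifferentiableWithinAt_univ] at this

theorem mfderiv_extChartAt_symm_chartField (V : ∀ x : M, TangentSpace I x) {x : M} {z : E}
    (hz : z ∈ (extChartAt I x).target) :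
    mfderiv 𝓘(ℝ, E) I (extChartAt I x).symm z (chartField (E := E) V x z) =
      V ((extChartAt I x).symm z) := by
  have h := isInvertible_mfderivWithin_extChartAt_symm (I := I) hz
  rw [chartField, VectorField.mpullbackWithin_apply, I.range_eq_univ,
      mfderivWithin_univ]
  rw [I.range_eq_univ, mfderivWithin_univ] at h
  exact h.self_apply_inverse _

theorem differentiableAt_chartField [FiniteDimensional ℝ E]
    {V : ∀ x : M, TangentSpace I x} {x : M} (hV : VFDiffAt I V x) :
    DifferentiableAt ℝ (chartField V x) (extChartAt I x x) := by
  have : CompleteSpace E := FiniteDimensional.complete ℝ E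
  rw [VFDiffAt, ← mdifferentiableWithinAt_univ] at hV
  have := hV.differentiableWithinAt_mpullbackWithin_vectorField
  rw [preimage_univ, univ_inter] at this
  rw [← differentiableWithinAt_univ]
  rwa [← I.range_eq_univ]

theorem mvfderiv_comp_extChartAt_symm {f : M → F} {x : M} {z : E}
    (V : ∀ x : M, TangentSpace I x)
    (hz : z ∈ (extChartAt I x).target)
    (hf : MDifferentiableAt I 𝓘(ℝ, F) f ((extChartAt I x).symm z)) :
    fderiv ℝ (f ∘ (extChartAt I x).symm) z (chartField V x z) =
      mvfderiv I f ((extChartAt I x).symm z) (V ((extChartAt I x).symm z)) := by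
  rw [← mfderiv_extChartAt_symm_chartField V hz]
  rw [← mfderiv_eq_fderiv, mfderiv_comp z hf (mdifferentiableAt_extChartAt_symm' hz)]
  rfl

theorem tendsto_extChartAt_symm (x : M) :
    Tendsto (extChartAt I x).symm (𝓝 (extChartAt I x x)) (𝓝 x) := by
  have := (mdifferentiableAt_extChartAt_symm' (mem_extChartAt_target (I := I) x)).continuousAt
  rwa [ContinuousAt, extChartAt_to_inv] at this

/-- Equality near the point is needed, since `mvfderiv_mlieBracket` differentiates both sides once
more. -/
theorem mvfderiv_comp_extChartAt_symm_eventuallyEq {f : M → F} {x : M}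
    (V : ∀ x : M, TangentSpace I x)
    (hf : ContMDiffAt I 𝓘(ℝ, F) 2 f x) :
    (fun z => fderiv ℝ (f ∘ (extChartAt I x).symm) z (chartField V x z))
      =ᶠ[𝓝 (extChartAt I x x)]
      (fun z => mvfderiv I f z (V z)) ∘ (extChartAt I x).symm := by
  have : IsManifold I 2 M := inferInstance
  filter_upwards [extChartAt_target_mem_nhds (I := I) x,
    (tendsto_extChartAt_symm x).eventually (eventually_contMDiffAt (by decide) hf)] with z hz hz'
  exact mvfderiv_comp_extChartAt_symm V hz (hz'.mdifferentiableAt (by simp))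

theorem contDiffAt_comp_extChartAt_symm {f : M → F} {x : M}
    (hf : ContMDiffAt I 𝓘(ℝ, F) 2 f x) :
    ContDiffAt ℝ 2 (f ∘ (extChartAt I x).symm) (extChartAt I x x) := by
  rw [← contMDiffAt_iff_contDiffAt]
  refine ContMDiffAt.comp (I' := I) _ (by rw [extChartAt_to_inv]; exact hf) ?_
  have := contMDiffWithinAt_extChartAt_symm_range (I := I) (n := 2) x
    (mem_extChartAt_target x)
  rwa [I.range_eq_univ, contMDiffWithinAt_univ] at this

/-- If `f` is `C^2` and `V` is a differentiable vector field then `df(V)` is differentiable. -/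
theorem mdifferentiableAt_mvfderiv_apply [FiniteDimensional ℝ E] {f : M → F} {x : M}
    {V : ∀ x : M, TangentSpace I x}
    (hf : ContMDiffAt I 𝓘(ℝ, F) 2 f x) (hV : VFDiffAt I V x) :
    MDifferentiableAt I 𝓘(ℝ, F) (fun z => mvfderiv I f z (V z)) x := by
  have h1 : DifferentiableAt ℝ
      (fun z => fderiv ℝ (f ∘ (extChartAt I x).symm) z (chartField V x z))
      (extChartAt I x x) :=
    (((contDiffAt_comp_extChartAt_symm hf).fderiv_right (m := 1)
      (by norm_num)).differentiableAt (by simp)).clm_apply (differentiableAt_chartField hV)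
  have h2 := h1.congr_of_eventuallyEq (mvfderiv_comp_extChartAt_symm_eventuallyEq V hf).symm
  have h3 := h2.mdifferentiableAt.comp x
    (mdifferentiableAt_extChartAt (I := I) (mem_chart_source H x))
  refine h3.congr_of_eventuallyEq ?_
  filter_upwards [extChartAt_source_mem_nhds (I := I) x] with z hz
  rw [Function.comp, Function.comp, (extChartAt I x).left_inv hz]

/-- The derivative of a function along `[V, W]` is the commutator of its derivatives along `V` and
`W`. -/
theorem mvfderiv_mlieBracket [FiniteDimensional ℝ E] {f : M → F} {x : M}
    {V W : ∀ x : M, TangentSpace I x}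
    (hf : ContMDiffAt I 𝓘(ℝ, F) 2 f x) (hV : VFDiffAt I V x) (hW : VFDiffAt I W x) :
    mvfderiv I f x (VectorField.mlieBracket I V W x) =
      mvfderiv I (fun z => mvfderiv I f z (W z)) x (V x) -
      mvfderiv I (fun z => mvfderiv I f z (V z)) x (W x) := by
  have hx := mem_extChartAt_target (I := I) x
  have key2 : ∀ (U : ∀ x : M, TangentSpace I x)
     (G : M → F) (hG : MDifferentiableAt I 𝓘(ℝ, F) G x),
      fderiv ℝ (G ∘ (extChartAt I x).symm) (extChartAt I x x)
        (chartField U x (extChartAt I x x)) = mvfderiv I G x (U x) := by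
    intro U G hG
    have h := mvfderiv_comp_extChartAt_symm (f := G) (x := x) U hx
      (by rwa [extChartAt_to_inv])
    rwa [extChartAt_to_inv] at h
  -- The flat identity `Df[V, W] = D(Df W) V - D(Df V) W`, read in the chart at `x` and then carried
  -- back to the manifold.
  have main := VectorField.fderiv_apply_lieBracket
    (V := chartField V x) (W := chartField W x) (contDiffAt_comp_extChartAt_symm hf)
    (by simp [minSmoothness_of_isRCLikeNormedField]) (differentiableAt_chartField hW)
    (differentiableAt_chartField hV)
  rw [Filter.EventuallyEq.fderiv_eq (mvfderiv_comp_extChartAt_symm_eventuallyEq W hf),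
    Filter.EventuallyEq.fderiv_eq (mvfderiv_comp_extChartAt_symm_eventuallyEq V hf),
    key2 _ _ (mdifferentiableAt_mvfderiv_apply hf hW),
    key2 _ _ (mdifferentiableAt_mvfderiv_apply hf hV)] at main
  rw [← main, ← key2 _ _ (hf.mdifferentiableAt (by simp)), chartField_self]
  congr 1
  rw [VectorField.mlieBracket, VectorField.mlieBracketWithin_apply, mfderiv_extChartAt_self,
    preimage_univ, univ_inter]
  have : ∀ v : E, (ContinuousLinearMap.id ℝ E).inverse v = v := by
    intro v
    rw [ContinuousLinearMap.inverse_id]; rfl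
  refine (this _).trans ?_
  have h3 : range I = univ := by rw [I.range_eq_univ]
  have h4 := VectorField.lieBracketWithin_univ (𝕜 := ℝ) (V := chartField V x)
    (W := chartField W x)
  rw [← h3] at h4
  exact congrFun h4 _

/-- Lie brackets of `f`-related vector fields are `f`-related. -/
theorem mfderiv_mlieBracket_of_related [FiniteDimensional ℝ E] [FiniteDimensional ℝ E']
    {f : M → N} {x : M}
    {V W : ∀ x : M, TangentSpace I x} {V' W' : ∀ x : N, TangentSpace J x}
    (hf : ContMDiffAt I J 2 f x) (hV : VFDiffAt I V x) (hW : VFDiffAt I W x)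
    (hV' : VFDiffAt J V' (f x)) (hW' : VFDiffAt J W' (f x))
    (hVV' : ∀ᶠ z in 𝓝 x, mfderiv I J f z (V z) = V' (f z))
    (hWW' : ∀ᶠ z in 𝓝 x, mfderiv I J f z (W z) = W' (f z)) :
    mfderiv I J f x (VectorField.mlieBracket I V W x) =
      VectorField.mlieBracket J V' W' (f x) := by
  -- The chart at `f x` serves as a vector-valued test function: the commutator formulas for `φ ∘ f`
  -- and `φ` agree, and `dφ` at `f x` is the identity, so the two brackets coincide as vectors.
  let φ : N → E' := fun z => extChartAt J (f x) z
  have cφ : ContMDiffAt J 𝓘(ℝ, E') 2 φ (f x) := contMDiffAt_extChartAt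
  have dφ := cφ.mdifferentiableAt (by simp)
  have df := hf.mdifferentiableAt (by simp)
  have ev : ∀ {U : ∀ x : M, TangentSpace I x} {U' : ∀ x : N, TangentSpace J x},
      (∀ᶠ z in 𝓝 x, mfderiv I J f z (U z) = U' (f z)) →
      (fun z => mvfderiv I (φ ∘ f) z (U z)) =ᶠ[𝓝 x]
      (fun z => mvfderiv J φ z (U' z)) ∘ f := by
    intro U U' hU
    filter_upwards [hU, eventually_contMDiffAt (by decide) hf,
      hf.continuousAt.eventually (eventually_contMDiffAt (by decide) cφ)] with z h1 h2 h3
    rw [mvfderiv_comp_apply_vector (h3.mdifferentiableAt (by simp)) (h2.mdifferentiableAt (by simp)),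
      h1]
    rfl
  have comp : ∀ {U : ∀ x : M, TangentSpace I x} {U' : ∀ x : N, TangentSpace J x}
      {G : N → E'}, MDifferentiableAt J 𝓘(ℝ, E') G (f x) →
      (∀ᶠ z in 𝓝 x, mfderiv I J f z (U z) = U' (f z)) →
      mvfderiv I (G ∘ f) x (U x) = mvfderiv J G (f x) (U' (f x)) := by
    intro U U' G hG hU
    rw [mvfderiv_comp_apply_vector hG df, hU.self_of_nhds]
  have h1 := mvfderiv_mlieBracket (cφ.comp x hf) hV hW
  rw [mvfderiv_congr (ev hVV'), mvfderiv_congr (ev hWW'),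
    comp (mdifferentiableAt_mvfderiv_apply cφ hW') hVV',
    comp (mdifferentiableAt_mvfderiv_apply cφ hV') hWW',
    ← mvfderiv_mlieBracket cφ hV' hW', mvfderiv_comp_apply_vector dφ df] at h1
  have inj : ∀ v : TangentSpace J (f x), mvfderiv J φ (f x) v = v := by
    intro v
    have := mfderiv_extChartAt_self (I := J) (x := f x)
    exact congrArg (fun L : E' →L[ℝ] E' => L v) this
  rwa [inj, inj] at h1

end Bracket

/-! ### Lie derivatives of fields of bilinear forms, and Killing fields. -/

section Killing

variable {E : Type*} [NormedAddCommGroup E] [NormedSpace ℝ E]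
  {M : Type*} [TopologicalSpace M] [ChartedSpace E M] [IsManifold 𝓘(ℝ, E) ∞ M]

/-- The Lie derivative `(L_Y h)(X₁, X₂)` of a field of bilinear forms at `x`. -/
def lieDerivative
    (h : ∀ x : M, TangentSpace 𝓘(ℝ, E) x →ₗ[ℝ] TangentSpace 𝓘(ℝ, E) x →ₗ[ℝ] ℝ)
    (Y X₁ X₂ : ∀ x : M, TangentSpace 𝓘(ℝ, E) x) (x : M) : ℝ :=
  mvfderiv 𝓘(ℝ, E) (fun z => h z (X₁ z) (X₂ z)) x (Y x) -
    (h x (VectorField.mlieBracket 𝓘(ℝ, E) Y X₁ x) (X₂ x) +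
      h x (X₁ x) (VectorField.mlieBracket 𝓘(ℝ, E) Y X₂ x))

variable {h : ∀ x : M, TangentSpace 𝓘(ℝ, E) x →ₗ[ℝ] TangentSpace 𝓘(ℝ, E) x →ₗ[ℝ] ℝ}

theorem isKilling_iff {Y : SmoothVF E M} :
    IsKilling (fun x v w => h x v w) Y ↔
      ∀ (X₁ X₂ : SmoothVF E M) (x : M), lieDerivative h Y X₁ X₂ x = 0 := by
  simp only [lieDerivative, sub_eq_zero]
  exact Iff.rfl

theorem SmoothVF.vfDiffAt (Y : SmoothVF E M) (x : M) : VFDiffAt 𝓘(ℝ, E) Y x :=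
  Y.mdifferentiableAt

theorem isKilling_zero : IsKilling (fun x v w => h x v w) (0 : SmoothVF E M) := by
  rw [isKilling_iff]
  intro X₁ X₂ x
  have h0 : ((0 : SmoothVF E M) : ∀ x : M, TangentSpace 𝓘(ℝ, E) x) = 0 := rfl
  rw [lieDerivative, h0, VectorField.mlieBracket_zero_left]
  simp

variable [FiniteDimensional ℝ E]

/-- The bracket of Killing fields is Killing. -/
theorem IsKilling.bracket
    (hs : ∀ X₁ X₂ : SmoothVF E M, ContMDiff 𝓘(ℝ, E) 𝓘(ℝ, ℝ) ∞ fun z => h z (X₁ z) (X₂ z))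
    {Y Z : SmoothVF E M} (hY : IsKilling (fun x v w => h x v w) Y)
    (hZ : IsKilling (fun x v w => h x v w) Z) :
    IsKilling (fun x v w => h x v w) ⁅Y, Z⁆ := by
  have form : ∀ {U : SmoothVF E M}, IsKilling (fun x v w => h x v w) U →
      ∀ X₁ X₂ : SmoothVF E M,
      (fun z => mvfderiv 𝓘(ℝ, E) (fun z => h z (X₁ z) (X₂ z)) z (U z)) =
      (fun z => h z (⁅U, X₁⁆ z) (X₂ z)) + fun z => h z (X₁ z) (⁅U, X₂⁆ z) := by
    intro U hU X₁ X₂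
    ext z
    exact hU X₁ X₂ z
  have dd : ∀ (X₁ X₂ : SmoothVF E M) (x : M),
      MDifferentiableAt 𝓘(ℝ, E) 𝓘(ℝ, ℝ) (fun z => h z (X₁ z) (X₂ z)) x :=
    fun X₁ X₂ x => (hs X₁ X₂ x).mdifferentiableAt (by simp)
  intro X₁ X₂ x
  -- In `YZ h(X₁, X₂) - ZY h(X₁, X₂)`, expanded by the Killing equations, mixed terms such as `h([Y,
  -- X₁], [Z, X₂])` cancel, and Jacobi (`j1`, `j2`) collects the others.
  have hb := mvfderiv_mlieBracket ((hs X₁ X₂ x).of_le (ENat.LEInfty.out))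
    (Y.vfDiffAt x) (Z.vfDiffAt x)
  refine Eq.trans hb ?_
  have e1 := fun U₁ U₂ : SmoothVF E M => congrFun (form hY U₁ U₂) x
  have e2 := fun U₁ U₂ : SmoothVF E M => congrFun (form hZ U₁ U₂) x
  have j1 : ⁅⁅Y, Z⁆, X₁⁆ x = ⁅Y, ⁅Z, X₁⁆⁆ x - ⁅Z, ⁅Y, X₁⁆⁆ x := by
    rw [lie_lie]; rfl
  have j2 : ⁅⁅Y, Z⁆, X₂⁆ x = ⁅Y, ⁅Z, X₂⁆⁆ x - ⁅Z, ⁅Y, X₂⁆⁆ x := by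
    rw [lie_lie]; rfl
  simp only [Pi.add_apply] at e1 e2
  rw [form hY, form hZ, mvfderiv_add (dd _ _ x) (dd _ _ x), mvfderiv_add (dd _ _ x) (dd _ _ x)]
  rw [_root_.add_apply, _root_.add_apply, e1, e1, e2, e2]
  change _ = h x (⁅⁅Y, Z⁆, X₁⁆ x) (X₂ x) + h x (X₁ x) (⁅⁅Y, Z⁆, X₂⁆ x)
  rw [j1, j2, map_sub, map_sub, LinearMap.sub_apply]
  ring

theorem IsKilling.add {Y Z : SmoothVF E M} (hY : IsKilling (fun x v w => h x v w) Y)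
    (hZ : IsKilling (fun x v w => h x v w) Z) : IsKilling (fun x v w => h x v w) (Y + Z) := by
  rw [isKilling_iff] at *
  intro X₁ X₂ x
  have := hY X₁ X₂ x
  have := hZ X₁ X₂ x
  have h0 : ((Y + Z : SmoothVF E M) : ∀ x : M, TangentSpace 𝓘(ℝ, E) x) = Y + Z := rfl
  simp only [lieDerivative, h0] at *
  rw [VectorField.mlieBracket_add_left (Y.vfDiffAt x) (Z.vfDiffAt x),
    VectorField.mlieBracket_add_left (Y.vfDiffAt x) (Z.vfDiffAt x), Pi.add_apply]
  simp only [map_add, LinearMap.add_apply]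
  linarith

theorem IsKilling.smul (c : ℝ) {Y : SmoothVF E M} (hY : IsKilling (fun x v w => h x v w) Y) :
    IsKilling (fun x v w => h x v w) (c • Y) := by
  rw [isKilling_iff] at *
  intro X₁ X₂ x
  have := hY X₁ X₂ x
  have h0 : ((c • Y : SmoothVF E M) : ∀ x : M, TangentSpace 𝓘(ℝ, E) x) = c • Y := rfl
  simp only [lieDerivative, h0] at *
  rw [VectorField.mlieBracket_const_smul_left (Y.vfDiffAt x),
    VectorField.mlieBracket_const_smul_left (Y.vfDiffAt x), Pi.smul_apply]
  simp only [map_smul, LinearMap.smul_apply, smul_eq_mul]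
  linear_combination c * this

/-- The Lie algebra of Killing fields of a smooth field of bilinear forms. -/
def killingAlgebra
    (h : ∀ x : M, TangentSpace 𝓘(ℝ, E) x →ₗ[ℝ] TangentSpace 𝓘(ℝ, E) x →ₗ[ℝ] ℝ)
    (hs : ∀ X₁ X₂ : SmoothVF E M, ContMDiff 𝓘(ℝ, E) 𝓘(ℝ, ℝ) ∞ fun z => h z (X₁ z) (X₂ z)) :
    LieSubalgebra ℝ (SmoothVF E M) where
  carrier := {Y | IsKilling (fun x v w => h x v w) Y}
  zero_mem' := isKilling_zero
  add_mem' := IsKilling.add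
  smul_mem' := IsKilling.smul
  lie_mem' := IsKilling.bracket hs

/-- The Lie derivative of a field of bilinear forms is tensorial. -/
theorem lieDerivative_pointwise
    {x : M} (hd : ∀ X₁ X₂ : (∀ x : M, TangentSpace 𝓘(ℝ, E) x),
      VFDiffAt 𝓘(ℝ, E) X₁ x → VFDiffAt 𝓘(ℝ, E) X₂ x →
      MDifferentiableAt 𝓘(ℝ, E) 𝓘(ℝ, ℝ) (fun z => h z (X₁ z) (X₂ z)) x)
    (Y : ∀ x : M, TangentSpace 𝓘(ℝ, E) x) {X₁ X₂ X₁' X₂' : ∀ x : M, TangentSpace 𝓘(ℝ, E) x}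
    (h₁ : VFDiffAt 𝓘(ℝ, E) X₁ x) (h₁' : VFDiffAt 𝓘(ℝ, E) X₁' x)
    (h₂ : VFDiffAt 𝓘(ℝ, E) X₂ x) (h₂' : VFDiffAt 𝓘(ℝ, E) X₂' x)
    (e₁ : X₁ x = X₁' x) (e₂ : X₂ x = X₂' x) :
    lieDerivative h Y X₁ X₂ x = lieDerivative h Y X₁' X₂' x := by
  have : CompleteSpace E := FiniteDimensional.complete ℝ E
  refine TensorialAt.pointwise₂ (I := 𝓘(ℝ, E)) (F := E) (F' := E)
    (Φ := fun X₁ X₂ => lieDerivative h Y X₁ X₂ x) ?_ ?_ h₁ h₁' h₂ h₂' e₁ e₂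
  · intro τ hτ
    constructor
    · intro f σ hf hσ
      have e : (fun z => h z ((f • σ) z) (τ z)) = f * fun z => h z (σ z) (τ z) := by
        ext z; simp
      simp only [lieDerivative, e]
      -- The derivative of `f` arises twice, from the product rule and from `[Y, f σ]`, and cancels.
      rw [mvfderiv_mul hf (hd σ τ hσ hτ), VectorField.mlieBracket_smul_right hf hσ]
      simp
      ring
    · intro σ σ' hσ hσ'
      have e : (fun z => h z ((σ + σ') z) (τ z)) =
        (fun z => h z (σ z) (τ z)) + fun z => h z (σ' z) (τ z) := by
        ext z; simp
      simp only [lieDerivative, e]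
      rw [mvfderiv_add (hd σ τ hσ hτ) (hd σ' τ hσ' hτ), VectorField.mlieBracket_add_right hσ hσ']
      simp
      ring
  · intro τ hτ
    constructor
    · intro f σ hf hσ
      have e : (fun z => h z (τ z) ((f • σ) z)) = f * fun z => h z (τ z) (σ z) := by
        ext z; simp
      simp only [lieDerivative, e]
      rw [mvfderiv_mul hf (hd τ σ hτ hσ), VectorField.mlieBracket_smul_right hf hσ]
      simp
      ring
    · intro σ σ' hσ hσ'
      have e : (fun z => h z (τ z) ((σ + σ') z)) =
        (fun z => h z (τ z) (σ z)) + fun z => h z (τ z) (σ' z) := by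
        ext z; simp
      simp only [lieDerivative, e]
      rw [mvfderiv_add (hd τ σ hτ hσ) (hd τ σ' hτ hσ'), VectorField.mlieBracket_add_right hσ hσ']
      simp
      ring

/-- Every tangent vector extends to a global smooth vector field. -/
theorem exists_smoothVF_apply_eq [T2Space M] [SecondCountableTopology M] (x : M)
    (v : TangentSpace 𝓘(ℝ, E) x) : ∃ Z : SmoothVF E M, Z x = v := by
  have : LocallyCompactSpace M := ChartedSpace.locallyCompactSpace E M
  -- The constraint is the single vector `v` at `x` and vacuous elsewhere. Both are convex, so local
  -- solutions can be glued by a partition of unity.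
  suffices h : ∃ s : SmoothVF E M, ∀ z, s z ∈ {w | ∀ e : z = x, w = e ▸ v} from
    let ⟨s, hs⟩ := h
    ⟨s, hs x rfl⟩
  refine exists_contMDiffSection_forall_mem_convex_of_local (n := ⊤) 𝓘(ℝ, E)
    (V := fun x : M => TangentSpace 𝓘(ℝ, E) x) (F_fiber := E)
    (t := fun z => {w | ∀ e : z = x, w = e ▸ v}) ?_ ?_
  · intro z a ha b hb s t _ _ hst e
    subst e
    rw [ha rfl, hb rfl, ← add_smul, hst, one_smul]
  · intro z
    by_cases e : z = x
    · subst e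
      obtain ⟨s, hs, h⟩ := FiberBundle.exists_contMDiffOn_extend (k := ∞) 𝓘(ℝ, E) E v
      refine ⟨s, hs, _, h, ?_⟩
      intro y _ e
      subst e
      simp
    · refine ⟨{x}ᶜ, isOpen_compl_singleton.mem_nhds e, 0,
        (contMDiff_zeroSection ℝ (fun x : M => TangentSpace 𝓘(ℝ, E) x)).contMDiffOn, ?_⟩
      intro y hy e
      exact absurd e hy

end Killing

/-! ### Principal bundles: local sections, fibres and vertical vectors. -/

section Principal

theorem surjective_mulInvariantVectorField
    {EK : Type*} [NormedAddCommGroup EK] [NormedSpace ℝ EK]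
    {K : Type*} [TopologicalSpace K] [ChartedSpace EK K] [Group K] [LieGroup 𝓘(ℝ, EK) ∞ K]
    (k : K) (w : TangentSpace 𝓘(ℝ, EK) k) :
    ∃ a : EK, mulInvariantVectorField (I := 𝓘(ℝ, EK)) (G := K) a k = w := by
  refine ⟨mfderiv 𝓘(ℝ, EK) 𝓘(ℝ, EK) (fun g : K => k⁻¹ * g) k w, ?_⟩
  have h := mfderiv_comp_apply_of_eq (I := 𝓘(ℝ, EK)) (I' := 𝓘(ℝ, EK)) (I'' := 𝓘(ℝ, EK)) k
    (f := fun g : K => k⁻¹ * g) (y := 1) (g := fun g : K => k * g)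
    ((contMDiff_mul_left (I := 𝓘(ℝ, EK)) (n := ∞)).mdifferentiableAt (by simp))
    ((contMDiff_mul_left (I := 𝓘(ℝ, EK)) (n := ∞)).mdifferentiableAt (by simp)) (by simp) w
  have e : (fun g : K => k * g) ∘ (fun g : K => k⁻¹ * g) = id := by
    ext g
    simp
  rw [e, mfderiv_id] at h
  exact h.symm


variable
    {EM : Type*} [NormedAddCommGroup EM] [NormedSpace ℝ EM]
    {M : Type*} [TopologicalSpace M] [ChartedSpace EM M]
    {EK : Type*} [NormedAddCommGroup EK] [NormedSpace ℝ EK]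
    {K : Type*} [TopologicalSpace K] [ChartedSpace EK K] [Group K]
    {EP : Type*} [NormedAddCommGroup EP] [NormedSpace ℝ EP]
    {P : Type*} [TopologicalSpace P] [ChartedSpace EP P] [MulAction Kᵐᵒᵖ P]
    {p : P → M} (hp : IsPrincipalBundle EM EK EP K p)

include hp

namespace IsPrincipalBundle

theorem contMDiff_smul (k : K) :
    ContMDiff 𝓘(ℝ, EP) 𝓘(ℝ, EP) ∞ (fun z : P => MulOpposite.op k • z) :=
  hp.contMDiff_act.comp (contMDiff_id.prodMk (contMDiff_const (c := k)))

theorem contMDiff_orbit (y : P) :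
    ContMDiff 𝓘(ℝ, EK) 𝓘(ℝ, EP) ∞ (fun k : K => MulOpposite.op k • y) :=
  hp.contMDiff_act.comp ((contMDiff_const (c := y)).prodMk contMDiff_id)

/-- Local sections `s` of a principal bundle, with the map `κ` such that `y = s(p(y)) κ(y)`. -/
theorem exists_local_section (x : M) :
    ∃ (U : Set M) (s : M → P) (κ : P → K), IsOpen U ∧ x ∈ U ∧
      ContMDiffOn 𝓘(ℝ, EM) 𝓘(ℝ, EP) ∞ s U ∧ (∀ z ∈ U, p (s z) = z) ∧
      ContMDiffOn 𝓘(ℝ, EP) 𝓘(ℝ, EK) ∞ κ (p ⁻¹' U) ∧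
      ∀ y ∈ p ⁻¹' U, MulOpposite.op (κ y) • s (p y) = y := by
  obtain ⟨U, e, hU, hx, hs, ht, he, he', h1, h2⟩ := hp.locally_trivial x
  have mt : ∀ z ∈ U, (z, (1 : K)) ∈ e.target := fun z hz => by rw [ht]; exact ⟨hz, trivial⟩
  have pe : ∀ z ∈ U, p (e.symm (z, (1 : K))) = z := by
    intro z hz
    rw [← h1 _ (e.map_target (mt z hz)), e.right_inv (mt z hz)]
  refine ⟨U, fun z => e.symm (z, 1), fun y => (e y).2, hU, hx, ?_, pe, ?_, ?_⟩
  · exact he'.comp (contMDiff_id.prodMk (contMDiff_const (c := (1 : K)))).contMDiffOn mt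
  · rw [← hs]
    exact contMDiff_snd.comp_contMDiffOn he
  · intro y hy
    have hyU : p y ∈ U := hy
    have hys : y ∈ e.source := by rwa [hs]
    have hss := e.map_target (mt _ hyU)
    -- The section has group coordinate `1`, so both points have coordinates `(p y, (e y).2)`.
    refine e.injOn ?_ hys ?_
    · rw [hs, mem_preimage, hp.proj_act, pe _ hyU]; exact hyU
    · rw [h2 _ hss, e.right_inv (mt _ hyU), one_mul, ← h1 y hys]

theorem surjective : Function.Surjective p := fun x => by
  obtain ⟨U, s, κ, hU, hx, hs, hps, hκ, h⟩ := hp.exists_local_section x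
  exact ⟨s x, hps x hx⟩

theorem exists_smul_eq {y y' : P} (h : p y = p y') : ∃ k : K, MulOpposite.op k • y = y' := by
  obtain ⟨U, s, κ, hU, hx, hs, hps, hκ, hh⟩ := hp.exists_local_section (p y)
  have h1 := hh y hx
  have h2 := hh y' (by rw [mem_preimage, ← h]; exact hx)
  -- Both points are translates of the same `s (p y)`, by `κ y` and by `κ y'`.
  refine ⟨(κ y)⁻¹ * κ y', ?_⟩
  rw [← h] at h2
  rw [show MulOpposite.op ((κ y)⁻¹ * κ y') • y =
    MulOpposite.op ((κ y)⁻¹ * κ y') • MulOpposite.op (κ y) • s (p y) by rw [h1], ← mul_smul,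
    ← MulOpposite.op_mul, mul_inv_cancel_left, h2]

theorem mfderiv_proj_smul (k : K) (y : P) (v : TangentSpace 𝓘(ℝ, EP) y) :
    mfderiv 𝓘(ℝ, EP) 𝓘(ℝ, EM) p (MulOpposite.op k • y)
      (mfderiv 𝓘(ℝ, EP) 𝓘(ℝ, EP) (fun z : P => MulOpposite.op k • z) y v) =
      (mfderiv 𝓘(ℝ, EP) 𝓘(ℝ, EM) p y v : EM) := by
  have h := mfderiv_comp_apply (I := 𝓘(ℝ, EP)) (I' := 𝓘(ℝ, EP)) (I'' := 𝓘(ℝ, EM)) y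
    (hp.contMDiff_proj.mdifferentiableAt (by simp))
    ((hp.contMDiff_smul k).mdifferentiableAt (by simp) : MDifferentiableAt 𝓘(ℝ, EP) 𝓘(ℝ, EP) _ y) v
  have e : p ∘ (fun z : P => MulOpposite.op k • z) = p := by
    ext z; exact hp.proj_act z k
  rw [e] at h
  exact h.symm

theorem mfderiv_proj_fundamental (y : P) (a : EK) :
    mfderiv 𝓘(ℝ, EP) 𝓘(ℝ, EM) p y (fundamental (EP := EP) K y a) = 0 := by
  have h := mfderiv_comp_apply_of_eq (I := 𝓘(ℝ, EK)) (I' := 𝓘(ℝ, EP)) (I'' := 𝓘(ℝ, EM)) (1 : K)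
    (f := fun k : K => MulOpposite.op k • y) (y := y)
    (hp.contMDiff_proj.mdifferentiableAt (x := y) (by simp))
    ((hp.contMDiff_orbit y).mdifferentiableAt (by simp)) (by simp) a
  have e : p ∘ (fun k : K => MulOpposite.op k • y) = fun _ => p y := by
    ext k; exact hp.proj_act y k
  rw [e, mfderiv_const] at h
  exact h.symm

/-- A local section splits `dp` at `s (p y)`; translation by `κ y` moves the resulting vector to `y`
without changing its projection. -/
theorem surjective_mfderiv_proj (y : P) (w : TangentSpace 𝓘(ℝ, EM) (p y)) :
    ∃ v, mfderiv 𝓘(ℝ, EP) 𝓘(ℝ, EM) p y v = w := by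
  obtain ⟨U, s, κ, hU, hx, hs, hps, hκ, hh⟩ := hp.exists_local_section (p y)
  have ds : MDifferentiableAt 𝓘(ℝ, EM) 𝓘(ℝ, EP) s (p y) :=
    (hs.contMDiffAt (hU.mem_nhds hx)).mdifferentiableAt (by simp)
  have e : p ∘ s =ᶠ[𝓝 (p y)] id := by
    filter_upwards [hU.mem_nhds hx] with z hz using hps z hz
  have h := mfderiv_comp_apply (I := 𝓘(ℝ, EM)) (I' := 𝓘(ℝ, EP)) (I'' := 𝓘(ℝ, EM)) (p y)
    (hp.contMDiff_proj.mdifferentiableAt (by simp)) ds w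
  rw [e.mfderiv_eq, mfderiv_id] at h
  have h2 := hp.mfderiv_proj_smul (κ y) (s (p y)) (mfderiv 𝓘(ℝ, EM) 𝓘(ℝ, EP) s (p y) w)
  have h3 := h2.trans h.symm
  have h4 := hh y hx
  have : ∀ y' : P, y' = y → (∃ v : EP, (mfderiv 𝓘(ℝ, EP) 𝓘(ℝ, EM) p y' v : EM) = w) →
    (∃ v : EP, (mfderiv 𝓘(ℝ, EP) 𝓘(ℝ, EM) p y v : EM) = w) := by
    rintro y' rfl h; exact h
  exact this _ h4 ⟨_, h3⟩

/-- The derivative of the action map. -/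
theorem mfderiv_act (y : P) (k : K) (u : TangentSpace 𝓘(ℝ, EP) y) (w : TangentSpace 𝓘(ℝ, EK) k) :
    mfderiv (𝓘(ℝ, EP).prod 𝓘(ℝ, EK)) 𝓘(ℝ, EP) (fun q : P × K => MulOpposite.op q.2 • q.1) (y, k)
      ((u, w) : EP × EK) =
    (mfderiv 𝓘(ℝ, EP) 𝓘(ℝ, EP) (fun z : P => MulOpposite.op k • z) y u : EP) +
      (mfderiv 𝓘(ℝ, EK) 𝓘(ℝ, EP) (fun k : K => MulOpposite.op k • y) k w : EP) :=
  mfderiv_prod_eq_add_apply (hp.contMDiff_act.mdifferentiableAt (by simp))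

variable [LieGroup 𝓘(ℝ, EK) ∞ K]

/-- The derivative of the orbit map at `k` on the left invariant field `a` is `a^#` at `y k`. -/
theorem mfderiv_orbit_mulInvariantVectorField (y : P) (k : K) (a : EK) :
    mfderiv 𝓘(ℝ, EK) 𝓘(ℝ, EP) (fun k : K => MulOpposite.op k • y) k
      (mulInvariantVectorField (I := 𝓘(ℝ, EK)) (G := K) a k) =
      fundamental (EP := EP) K (MulOpposite.op k • y) a := by
  have h := mfderiv_comp_apply_of_eq (I := 𝓘(ℝ, EK)) (I' := 𝓘(ℝ, EK)) (I'' := 𝓘(ℝ, EP)) (1 : K)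
    (f := fun g : K => k * g) (y := k) (g := fun k : K => MulOpposite.op k • y)
    ((hp.contMDiff_orbit y).mdifferentiableAt (by simp))
    ((contMDiff_mul_left (I := 𝓘(ℝ, EK)) (n := ∞)).mdifferentiableAt (by simp)) (by simp) a
  have e : (fun k : K => MulOpposite.op k • y) ∘ (fun g : K => k * g) =
      fun g => MulOpposite.op g • MulOpposite.op k • y := by
    ext g
    simp [mul_smul]
  rw [e] at h
  exact h.symm

/-- The vertical tangent vectors are the values of the fundamental fields. -/
theorem exists_fundamental_eq {y : P} {v : TangentSpace 𝓘(ℝ, EP) y}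
    (hv : mfderiv 𝓘(ℝ, EP) 𝓘(ℝ, EM) p y v = 0) : ∃ a : EK, fundamental K y a = v := by
  obtain ⟨U, s, κ, hU, hx, hs, hps, hκ, hh⟩ := hp.exists_local_section (p y)
  have hU' : p ⁻¹' U ∈ 𝓝 y := (hU.preimage hp.contMDiff_proj.continuous).mem_nhds hx
  have ds : MDifferentiableAt 𝓘(ℝ, EM) 𝓘(ℝ, EP) s (p y) :=
    (hs.contMDiffAt (hU.mem_nhds hx)).mdifferentiableAt (by simp)
  have dκ : MDifferentiableAt 𝓘(ℝ, EP) 𝓘(ℝ, EK) κ y :=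
    (hκ.contMDiffAt hU').mdifferentiableAt (by simp)
  have dp : MDifferentiableAt 𝓘(ℝ, EP) 𝓘(ℝ, EM) p y :=
    hp.contMDiff_proj.mdifferentiableAt (by simp)
  -- Differentiating `z = s(p z) κ(z)` along `v`: the part through `s ∘ p` dies because `dp(v) = 0`,
  -- which leaves the orbit map applied to `dκ(v)`.
  have e : (fun q : P × K => MulOpposite.op q.2 • q.1) ∘ (fun z => (s (p z), κ z)) =ᶠ[𝓝 y] id := by
    filter_upwards [hU'] with z hz
    exact hh z hz
  have dsp : MDifferentiableAt 𝓘(ℝ, EP) 𝓘(ℝ, EP) (fun z => s (p z)) y := ds.comp y dp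
  have h := mfderiv_comp_apply (I := 𝓘(ℝ, EP)) (I' := 𝓘(ℝ, EP).prod 𝓘(ℝ, EK)) (I'' := 𝓘(ℝ, EP)) y
    (hp.contMDiff_act.mdifferentiableAt (by simp)) (dsp.prodMk dκ) v
  rw [e.mfderiv_eq, mfderiv_id, mfderiv_prodMk dsp dκ] at h
  have h' := h.trans (hp.mfderiv_act (s (p y)) (κ y) (mfderiv 𝓘(ℝ, EP) 𝓘(ℝ, EP) (s ∘ p) y v)
    (mfderiv 𝓘(ℝ, EP) 𝓘(ℝ, EK) κ y v))
  rw [mfderiv_comp_apply y ds dp, hv] at h'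
  obtain ⟨a, ha⟩ := surjective_mulInvariantVectorField (EK := EK) (κ y)
    (mfderiv 𝓘(ℝ, EP) 𝓘(ℝ, EK) κ y v)
  refine ⟨a, ?_⟩
  rw [← ha] at h'
  have h2 := hp.mfderiv_orbit_mulInvariantVectorField (s (p y)) (κ y) a
  have h3 := hh y hx
  rw [h3] at h2
  refine Eq.trans ?_ h'.symm
  rw [map_zero, map_zero, zero_add]
  exact h2.symm
end IsPrincipalBundle
end Principal

/-! ### Smoothness of vertical fields and of horizontal lifts. -/

section Smooth

theorem contMDiff_tangentBundle_fiber {E : Type*} [NormedAddCommGroup E] [NormedSpace ℝ E]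
    {M : Type*} [TopologicalSpace M] [ChartedSpace E M] [IsManifold 𝓘(ℝ, E) ∞ M] (x : M) :
    ContMDiff 𝓘(ℝ, E) (𝓘(ℝ, E).prod 𝓘(ℝ, E)) ∞ (fun a : E => (⟨x, a⟩ : TangentBundle 𝓘(ℝ, E) M)) := by
  intro a
  rw [contMDiffAt_totalSpace]
  refine ⟨contMDiffAt_const, ?_⟩
  have : (fun b : E => (trivializationAt E (TangentSpace 𝓘(ℝ, E)) x
      (⟨x, b⟩ : TangentBundle 𝓘(ℝ, E) M)).2) = id := by
    ext b
    exact (tangentBundleCore 𝓘(ℝ, E) M).coordChange_self (achart E x) x (mem_achart_source E x) b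
  exact this ▸ contMDiffAt_id

variable
    {EM : Type*} [NormedAddCommGroup EM] [NormedSpace ℝ EM]
    {M : Type*} [TopologicalSpace M] [ChartedSpace EM M]
    {EK : Type*} [NormedAddCommGroup EK] [NormedSpace ℝ EK]
    {K : Type*} [TopologicalSpace K] [ChartedSpace EK K] [Group K]
    {EP : Type*} [NormedAddCommGroup EP] [NormedSpace ℝ EP]
    {P : Type*} [TopologicalSpace P] [ChartedSpace EP P] [MulAction Kᵐᵒᵖ P]
    {p : P → M} (hp : IsPrincipalBundle EM EK EP K p)
    {E : Type*} [NormedAddCommGroup E] [NormedSpace ℝ E]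
    {H : Type*} [TopologicalSpace H] {I : ModelWithCorners ℝ E H}
    {N : Type*} [TopologicalSpace N] [ChartedSpace H N]
    [IsManifold 𝓘(ℝ, EP) ∞ P]

variable (A : Connection EK EP K P)

theorem Connection.contMDiffAt_form_apply {V : ∀ y : P, TangentSpace 𝓘(ℝ, EP) y} {y : P}
    (hV : ContMDiffAt 𝓘(ℝ, EP) (𝓘(ℝ, EP).prod 𝓘(ℝ, EP)) ∞
      (fun z => (⟨z, V z⟩ : TangentBundle 𝓘(ℝ, EP) P)) y) :
    ContMDiffAt 𝓘(ℝ, EP) 𝓘(ℝ, EK) ∞ (fun z => A.form z (V z)) y := by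
  have := ContMDiffAt.clm_bundle_apply (F₁ := EP) (F₂ := EK) (E₂ := Bundle.Trivial P EK)
    (b := fun y : P => y) (A.contMDiff_form y) hV
  rw [contMDiffAt_totalSpace] at this
  exact this.2

theorem Connection.mdifferentiableAt_form_apply {V : ∀ y : P, TangentSpace 𝓘(ℝ, EP) y} {y : P}
    (hV : VFDiffAt 𝓘(ℝ, EP) V y) :
    MDifferentiableAt 𝓘(ℝ, EP) 𝓘(ℝ, EK) (fun z => A.form z (V z)) y := by
  have := MDifferentiableAt.clm_bundle_apply (F₁ := EP) (F₂ := EK) (E₂ := Bundle.Trivial P EK)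
    (b := fun y : P => y) ((A.contMDiff_form y).mdifferentiableAt (by simp)) hV
  rw [mdifferentiableAt_totalSpace] at this
  exact this.2

variable [LieGroup 𝓘(ℝ, EK) ∞ K]

/-- The derivative of the action map on smooth families of tangent vectors. -/
theorem IsPrincipalBundle.contMDiffAt_tangentMap_act (hp : IsPrincipalBundle EM EK EP K p)
    {x : N} {U : N → TangentBundle 𝓘(ℝ, EP) P}
    {W : N → TangentBundle 𝓘(ℝ, EK) K}
    (hU : ContMDiffAt I (𝓘(ℝ, EP).prod 𝓘(ℝ, EP)) ∞ U x)
    (hW : ContMDiffAt I (𝓘(ℝ, EK).prod 𝓘(ℝ, EK)) ∞ W x) :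
    ContMDiffAt I (𝓘(ℝ, EP).prod 𝓘(ℝ, EP)) ∞
      (fun z => (⟨MulOpposite.op (W z).1 • (U z).1,
        (mfderiv 𝓘(ℝ, EP) 𝓘(ℝ, EP) (fun y : P => MulOpposite.op (W z).1 • y) (U z).1 (U z).2 : EP) +
        (mfderiv 𝓘(ℝ, EK) 𝓘(ℝ, EP) (fun k : K => MulOpposite.op k • (U z).1) (W z).1 (W z).2 : EP)⟩ :
        TangentBundle 𝓘(ℝ, EP) P)) x := by
  have h1 := (contMDiff_equivTangentBundleProd_symm (n := ∞) (I := 𝓘(ℝ, EP)) (I' := 𝓘(ℝ, EK))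
    (M := P) (M' := K)).contMDiffAt.comp x (hU.prodMk hW)
  have h2 := (hp.contMDiff_act.contMDiff_tangentMap (m := ∞) (by simp)).contMDiffAt.comp x h1
  refine h2.congr_of_eventuallyEq (Eventually.of_forall fun z => ?_)
  have := hp.mfderiv_act (U z).1 (W z).1 (U z).2 (W z).2
  exact congrArg (fun v : EP => (⟨MulOpposite.op (W z).1 • (U z).1, v⟩ : TangentBundle 𝓘(ℝ, EP) P))
    this.symm

/-- The vertical field with a smooth `𝔨`-valued coefficient is smooth. -/
theorem IsPrincipalBundle.contMDiffAt_fundamental (hp : IsPrincipalBundle EM EK EP K p)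
    {ν : P → EK} {y : P} (hν : ContMDiffAt 𝓘(ℝ, EP) 𝓘(ℝ, EK) ∞ ν y) :
    ContMDiffAt 𝓘(ℝ, EP) (𝓘(ℝ, EP).prod 𝓘(ℝ, EP)) ∞
      (fun z => (⟨z, fundamental K z (ν z)⟩ : TangentBundle 𝓘(ℝ, EP) P)) y := by
  have h1 : ContMDiffAt 𝓘(ℝ, EP) (𝓘(ℝ, EP).prod 𝓘(ℝ, EP)) ∞
    (fun z : P => (⟨z, 0⟩ : TangentBundle 𝓘(ℝ, EP) P)) y :=
    contMDiff_zeroSection ℝ (fun x : P => TangentSpace 𝓘(ℝ, EP) x) y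
  have h2 := (contMDiff_tangentBundle_fiber (1 : K)).contMDiffAt.comp y hν
  refine (hp.contMDiffAt_tangentMap_act h1 h2).congr_of_eventuallyEq
    (Eventually.of_forall fun z => ?_)
  refine Bundle.TotalSpace.ext (by simp) ?_
  have : (fundamental K z (ν z) : EP) =
    (mfderiv 𝓘(ℝ, EP) 𝓘(ℝ, EP) (fun y : P => MulOpposite.op (1 : K) • y) z 0 : EP) +
        (mfderiv 𝓘(ℝ, EK) 𝓘(ℝ, EP) (fun k : K => MulOpposite.op k • z) 1 (ν z) : EP) := by
    rw [map_zero, zero_add]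
    rfl
  exact heq_of_eq this

variable {A}

section Lift

include hp

/-- A tangent vector is determined by its projection and its vertical component. -/
theorem Connection.eq_of_proj_form_eq {y : P} {u v : TangentSpace 𝓘(ℝ, EP) y}
    (h1 : mfderiv 𝓘(ℝ, EP) 𝓘(ℝ, EM) p y u = mfderiv 𝓘(ℝ, EP) 𝓘(ℝ, EM) p y v)
    (h2 : A.form y u = A.form y v) : u = v := by
  obtain ⟨a, ha⟩ := hp.exists_fundamental_eq (y := y) (v := u - v) (by rw [map_sub, h1, sub_self])
  have : a = 0 := by rw [← A.form_fundamental y a, ha, map_sub, h2, sub_self]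
  rw [this, map_zero] at ha
  exact sub_eq_zero.1 ha.symm

variable [FiniteDimensional ℝ EP]

/-- A preimage under `dp` can be corrected by a fundamental vector to any prescribed value of `ω`.
Since `ContinuousLinearMap.inverse` is zero on non-invertible maps, this lemma is what gives
`Connection.lift` its meaning. -/
theorem Connection.isInvertible_proj_prod_form (y : P) :
    ((mfderiv 𝓘(ℝ, EP) 𝓘(ℝ, EM) p y).prod (A.form y)).IsInvertible := by
  let L : EP →L[ℝ] EM × EK := (mfderiv 𝓘(ℝ, EP) 𝓘(ℝ, EM) p y).prod (A.form y)
  have hL : Function.Bijective L := by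
    constructor
    · intro u v huv
      exact A.eq_of_proj_form_eq hp (congrArg Prod.fst huv) (congrArg Prod.snd huv)
    · rintro ⟨w, a⟩
      obtain ⟨v, hv⟩ := hp.surjective_mfderiv_proj y w
      refine ⟨(v + fundamental K y (a - A.form y v) : TangentSpace 𝓘(ℝ, EP) y), Prod.ext ?_ ?_⟩
      · refine Eq.trans (map_add (mfderiv 𝓘(ℝ, EP) 𝓘(ℝ, EM) p y) _ _) ?_
        rw [hp.mfderiv_proj_fundamental, hv]
        exact add_zero (w : EM)
      · refine Eq.trans (map_add (A.form y) _ _) ?_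
        rw [A.form_fundamental]
        simp
  exact ⟨(LinearEquiv.ofBijective L.toLinearMap hL).toContinuousLinearEquiv, rfl⟩

theorem Connection.proj_prod_form_lift (X : ∀ x : M, TangentSpace 𝓘(ℝ, EM) x) (y : P) :
    ((mfderiv 𝓘(ℝ, EP) 𝓘(ℝ, EM) p y).prod (A.form y)) (A.lift p X y) = (X (p y), 0) :=
  (A.isInvertible_proj_prod_form hp y).self_apply_inverse _

theorem Connection.mfderiv_proj_lift (X : ∀ x : M, TangentSpace 𝓘(ℝ, EM) x) (y : P) :
    mfderiv 𝓘(ℝ, EP) 𝓘(ℝ, EM) p y (A.lift p X y) = X (p y) :=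
  congrArg Prod.fst (A.proj_prod_form_lift hp X y)

theorem Connection.form_lift (X : ∀ x : M, TangentSpace 𝓘(ℝ, EM) x) (y : P) :
    A.form y (A.lift p X y) = 0 :=
  congrArg Prod.snd (A.proj_prod_form_lift hp X y)

/-- The horizontal lift of a smooth vector field is smooth. -/
theorem Connection.contMDiff_lift [IsManifold 𝓘(ℝ, EM) ∞ M] (X : SmoothVF EM M) :
    ContMDiff 𝓘(ℝ, EP) (𝓘(ℝ, EP).prod 𝓘(ℝ, EP)) ∞
      (fun z => (⟨z, A.lift p X z⟩ : TangentBundle 𝓘(ℝ, EP) P)) := by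
  intro y
  obtain ⟨U, s, κ, hU, hx, hs, hps, hκ, hh⟩ := hp.exists_local_section (p y)
  have hU' : p ⁻¹' U ∈ 𝓝 y := (hU.preimage hp.contMDiff_proj.continuous).mem_nhds hx
  have ds : ∀ z ∈ U, MDifferentiableAt 𝓘(ℝ, EM) 𝓘(ℝ, EP) s z := fun z hz =>
    (hs.contMDiffAt (hU.mem_nhds hz)).mdifferentiableAt (by simp)
  -- a local lift, by translation of a local section
  let W : ∀ z : P, TangentSpace 𝓘(ℝ, EP) z := fun z =>
    (mfderiv 𝓘(ℝ, EP) 𝓘(ℝ, EP) (fun y : P => MulOpposite.op (κ z) • y) (s (p z))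
      (mfderiv 𝓘(ℝ, EM) 𝓘(ℝ, EP) s (p z) (X (p z))) : EP)
  have hS : ContMDiffAt 𝓘(ℝ, EP) (𝓘(ℝ, EP).prod 𝓘(ℝ, EP)) ∞
      (fun z => (⟨s (p z), mfderiv 𝓘(ℝ, EM) 𝓘(ℝ, EP) s (p z) (X (p z))⟩ :
        TangentBundle 𝓘(ℝ, EP) P)) y := by
    have h1 := hs.contMDiffOn_tangentMapWithin (m := ∞) (by simp) hU.uniqueMDiffOn
    have h2 := h1.contMDiffAt (x := (⟨p y, X (p y)⟩ : TangentBundle 𝓘(ℝ, EM) M))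
      ((hU.preimage (FiberBundle.continuous_proj EM (TangentSpace 𝓘(ℝ, EM)))).mem_nhds hx)
    have h3 := h2.comp y ((X.contMDiff (p y)).comp y (hp.contMDiff_proj y))
    refine h3.congr_of_eventuallyEq ?_
    filter_upwards [hU'] with z hz
    refine congrArg (fun v : EP => (⟨s (p z), v⟩ : TangentBundle 𝓘(ℝ, EP) P)) ?_
    change _ = mfderivWithin 𝓘(ℝ, EM) 𝓘(ℝ, EP) s U (p z) (X (p z))
    rw [mfderivWithin_of_isOpen hU hz]
  have hK : ContMDiffAt 𝓘(ℝ, EP) (𝓘(ℝ, EK).prod 𝓘(ℝ, EK)) ∞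
      (fun z => (⟨κ z, 0⟩ : TangentBundle 𝓘(ℝ, EK) K)) y :=
    (contMDiff_zeroSection ℝ (fun x : K => TangentSpace 𝓘(ℝ, EK) x) (κ y)).comp y
      (hκ.contMDiffAt hU')
  have hW : ContMDiffAt 𝓘(ℝ, EP) (𝓘(ℝ, EP).prod 𝓘(ℝ, EP)) ∞
      (fun z => (⟨z, W z⟩ : TangentBundle 𝓘(ℝ, EP) P)) y := by
    refine (hp.contMDiffAt_tangentMap_act hS hK).congr_of_eventuallyEq ?_
    filter_upwards [hU'] with z hz
    refine Bundle.TotalSpace.ext (hh z hz).symm (heq_of_eq ?_)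
    dsimp only
    rw [map_zero, add_zero]
  -- Subtracting the vertical component of `W` keeps the projection and makes the field horizontal,
  -- so by uniqueness it is the lift.
  have hV := hp.contMDiffAt_fundamental (A.contMDiffAt_form_apply hW)
  refine (hW.sub_section hV).congr_of_eventuallyEq ?_
  filter_upwards [hU'] with z hz
  refine congrArg (fun v => (⟨z, v⟩ : TangentBundle 𝓘(ℝ, EP) P)) ?_
  refine A.eq_of_proj_form_eq hp ?_ ?_
  · rw [A.mfderiv_proj_lift hp]
    change _ = mfderiv 𝓘(ℝ, EP) 𝓘(ℝ, EM) p z (W z - fundamental K z (A.form z (W z)))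
    rw [map_sub, hp.mfderiv_proj_fundamental, sub_zero]
    have e : p ∘ s =ᶠ[𝓝 (p z)] id := by
      filter_upwards [hU.mem_nhds hz] with z hz using hps z hz
    have h := mfderiv_comp_apply (I := 𝓘(ℝ, EM)) (I' := 𝓘(ℝ, EP)) (I'' := 𝓘(ℝ, EM)) (p z)
      (hp.contMDiff_proj.mdifferentiableAt (by simp)) (ds _ hz) (X (p z))
    rw [e.mfderiv_eq, mfderiv_id] at h
    have h2 := hp.mfderiv_proj_smul (κ z) (s (p z))
      (mfderiv 𝓘(ℝ, EM) 𝓘(ℝ, EP) s (p z) (X (p z)))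
    rw [hh z hz] at h2
    exact (h2.trans h.symm).symm
  · rw [A.form_lift hp]
    change _ = A.form z (W z - fundamental K z (A.form z (W z)))
    rw [map_sub, A.form_fundamental, sub_self]

end Lift
end Smooth

/-! ### Brackets of invariant fields with vertical fields. -/

section Invariant

variable
    {EM : Type*} [NormedAddCommGroup EM] [NormedSpace ℝ EM]
    {M : Type*} [TopologicalSpace M] [ChartedSpace EM M]
    {EK : Type*} [NormedAddCommGroup EK] [NormedSpace ℝ EK] [FiniteDimensional ℝ EK]
    {K : Type*} [TopologicalSpace K] [ChartedSpace EK K] [Group K]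
    {EP : Type*} [NormedAddCommGroup EP] [NormedSpace ℝ EP] [FiniteDimensional ℝ EP]
    {P : Type*} [TopologicalSpace P] [ChartedSpace EP P] [MulAction Kᵐᵒᵖ P]
    {p : P → M} (hp : IsPrincipalBundle EM EK EP K p)
    [IsManifold 𝓘(ℝ, EP) ∞ P] [LieGroup 𝓘(ℝ, EK) ∞ K]

theorem vfDiffAt_mulInvariantVectorField (a : EK) (k : K) :
    VFDiffAt 𝓘(ℝ, EK) (mulInvariantVectorField (I := 𝓘(ℝ, EK)) (G := K) a) k := by
  have : CompleteSpace EK := FiniteDimensional.complete ℝ EK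
  have : LieGroup 𝓘(ℝ, EK) (minSmoothness ℝ 3) K := by
    rw [minSmoothness_of_isRCLikeNormedField]
    exact LieGroup.of_le (n := ∞) ENat.LEInfty.out
  exact mdifferentiableAt_mulInvariantVectorField (I := 𝓘(ℝ, EK)) (G := K) a

/-- The fundamental fields of a principal bundle commute with the invariant vector fields. -/
theorem IsPrincipalBundle.mlieBracket_fundamental (hp : IsPrincipalBundle EM EK EP K p)
    {Y : SmoothVF EP P} (hY : IsInvariant K Y) (a : EK) (y : P) :
    VectorField.mlieBracket 𝓘(ℝ, EP) Y (fun z => fundamental K z a) y = 0 := by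
  -- No flows are needed: on `P × K` the fields `(Y, 0)` and `(0, a)`, with `a` left invariant,
  -- commute. The action map relates them to `Y`, by invariance, and to `a^#`.
  let Y' : ∀ q : P × K, TangentSpace (𝓘(ℝ, EP).prod 𝓘(ℝ, EK)) q := fun q => ((Y q.1, 0) : EP × EK)
  let a' : ∀ q : P × K, TangentSpace (𝓘(ℝ, EP).prod 𝓘(ℝ, EK)) q := fun q =>
    ((0, mulInvariantVectorField (I := 𝓘(ℝ, EK)) (G := K) a q.2) : EP × EK)
  have prod_diff : ∀ {U : ∀ z : P, TangentSpace 𝓘(ℝ, EP) z} {W : ∀ k : K, TangentSpace 𝓘(ℝ, EK) k}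
      (q : P × K), VFDiffAt 𝓘(ℝ, EP) U q.1 → VFDiffAt 𝓘(ℝ, EK) W q.2 →
      VFDiffAt (𝓘(ℝ, EP).prod 𝓘(ℝ, EK)) (fun q : P × K => ((U q.1, W q.2) : EP × EK)) q := by
    intro U W q hU hW
    exact ((contMDiff_equivTangentBundleProd_symm (n := ∞) (I := 𝓘(ℝ, EP)) (I' := 𝓘(ℝ, EK))
      (M := P) (M' := K)).mdifferentiableAt (by simp)).comp q
      ((hU.comp q mdifferentiableAt_fst).prodMk (hW.comp q mdifferentiableAt_snd))
  have z1 : ∀ z : P, VFDiffAt 𝓘(ℝ, EP) 0 z := fun z =>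
    (contMDiff_zeroSection (n := ∞) ℝ (fun x : P => TangentSpace 𝓘(ℝ, EP) x)).mdifferentiableAt
      (by simp)
  have z2 : ∀ z : K, VFDiffAt 𝓘(ℝ, EK) 0 z := fun z =>
    (contMDiff_zeroSection (n := ∞) ℝ (fun x : K => TangentSpace 𝓘(ℝ, EK) x)).mdifferentiableAt
      (by simp)
  have dY' : VFDiffAt (𝓘(ℝ, EP).prod 𝓘(ℝ, EK)) Y' (y, 1) :=
    prod_diff (y, 1) (Y.vfDiffAt y) (z2 1)
  have da' : VFDiffAt (𝓘(ℝ, EP).prod 𝓘(ℝ, EK)) a' (y, 1) :=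
    prod_diff (y, 1) (z1 y) (vfDiffAt_mulInvariantVectorField a 1)
  -- Each factor projection of this bracket is a bracket with the zero field.
  have b0 : VectorField.mlieBracket (𝓘(ℝ, EP).prod 𝓘(ℝ, EK)) Y' a' (y, 1) = 0 := by
    have h1 := mfderiv_mlieBracket_of_related (f := @Prod.fst P K) (x := (y, 1)) (V' := Y) (W' := 0)
      contMDiffAt_fst dY' da' (Y.vfDiffAt y) (z1 y)
      (Eventually.of_forall fun q => by rw [mfderiv_fst]; rfl)
      (Eventually.of_forall fun q => by rw [mfderiv_fst]; rfl)
    have h2 := mfderiv_mlieBracket_of_related (f := @Prod.snd P K) (x := (y, 1)) (V' := 0)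
      (W' := mulInvariantVectorField (I := 𝓘(ℝ, EK)) (G := K) a)
      contMDiffAt_snd dY' da' (z2 1) (vfDiffAt_mulInvariantVectorField a 1)
      (Eventually.of_forall fun q => by rw [mfderiv_snd]; rfl)
      (Eventually.of_forall fun q => by rw [mfderiv_snd]; rfl)
    rw [mfderiv_fst, VectorField.mlieBracket_zero_right] at h1
    rw [mfderiv_snd, VectorField.mlieBracket_zero_left] at h2
    exact Prod.ext h1 h2
  have da : ∀ z, VFDiffAt 𝓘(ℝ, EP) (fun z : P => fundamental K z a) z := fun z =>
    (hp.contMDiffAt_fundamental (contMDiffAt_const (c := a))).mdifferentiableAt (by simp)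
  have h := mfderiv_mlieBracket_of_related (f := fun q : P × K => MulOpposite.op q.2 • q.1)
    (x := (y, 1)) (V' := Y) (W' := fun z => fundamental K z a)
    ((hp.contMDiff_act (y, 1)).of_le ENat.LEInfty.out) dY' da' (Y.vfDiffAt _) (da _)
    (Eventually.of_forall fun q => ?_) (Eventually.of_forall fun q => ?_)
  · rw [b0, map_zero] at h
    have e : MulOpposite.op (1 : K) • y = y := by simp
    have : ∀ z, z = y → 0 = VectorField.mlieBracket 𝓘(ℝ, EP) Y (fun z => fundamental K z a) z →
      VectorField.mlieBracket 𝓘(ℝ, EP) Y (fun z => fundamental K z a) y = 0 := by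
      rintro z rfl h
      exact h.symm
    exact this _ e h
  · refine (hp.mfderiv_act q.1 q.2 (Y q.1) 0).trans ?_
    rw [map_zero, add_zero]
    exact hY q.2 q.1
  · refine (hp.mfderiv_act q.1 q.2 0 _).trans ?_
    rw [map_zero, zero_add]
    exact hp.mfderiv_orbit_mulInvariantVectorField q.1 q.2 a

/-- The bracket of an invariant vector field with a vertical field. -/
theorem IsPrincipalBundle.mlieBracket_vertical (hp : IsPrincipalBundle EM EK EP K p)
    {Y : SmoothVF EP P} (hY : IsInvariant K Y) {ν : P → EK} (hν : ContMDiff 𝓘(ℝ, EP) 𝓘(ℝ, EK) ∞ ν)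
    (y : P) :
    VectorField.mlieBracket 𝓘(ℝ, EP) Y (fun z => fundamental K z (ν z)) y =
      fundamental K y (mvfderiv 𝓘(ℝ, EP) ν y (Y y)) := by
  have : CompleteSpace EP := FiniteDimensional.complete ℝ EP
  -- For `f a^#` only the derivative of `f` survives, because `[Y, a^#] = 0`. A general `ν` is a
  -- finite sum of such terms in a basis of `𝔨`.
  have key : ∀ (f : P → ℝ) (a : EK), ContMDiff 𝓘(ℝ, EP) 𝓘(ℝ, ℝ) ∞ f →
      VectorField.mlieBracket 𝓘(ℝ, EP) Y (fun z => fundamental K z (f z • a)) y =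
      fundamental K y (mvfderiv 𝓘(ℝ, EP) (fun z => f z • a) y (Y y)) := by
    intro f a hf
    have e : (fun z => fundamental K z (f z • a)) = (f • fun z => fundamental (EP := EP) K z a) := by
      ext z; simp
    have df : MDifferentiableAt 𝓘(ℝ, EP) 𝓘(ℝ, ℝ) f y := hf.mdifferentiableAt (by simp)
    rw [e, VectorField.mlieBracket_smul_right df
      ((hp.contMDiffAt_fundamental (contMDiffAt_const (c := a))).mdifferentiableAt (by simp)),
      hp.mlieBracket_fundamental hY, smul_zero, add_zero]
    rw [mvfderiv_fun_smul df mdifferentiableAt_const, mvfderiv_const]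
    simp
  have sum : ∀ (s : Finset (Module.Basis.ofVectorSpaceIndex ℝ EK))
      (f : Module.Basis.ofVectorSpaceIndex ℝ EK → P → ℝ)
      (b : Module.Basis.ofVectorSpaceIndex ℝ EK → EK),
      (∀ i, ContMDiff 𝓘(ℝ, EP) 𝓘(ℝ, ℝ) ∞ (f i)) →
      VectorField.mlieBracket 𝓘(ℝ, EP) Y (fun z => fundamental K z (∑ i ∈ s, f i z • b i)) y =
      fundamental K y (mvfderiv 𝓘(ℝ, EP) (fun z => ∑ i ∈ s, f i z • b i) y (Y y)) := by
    classical
    intro s f b hf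
    have smooth : ∀ i, ContMDiff 𝓘(ℝ, EP) 𝓘(ℝ, EK) ∞ fun z => f i z • b i := fun i =>
      (hf i).smul contMDiff_const
    induction s using Finset.induction_on with
    | empty =>
      simp only [Finset.sum_empty, map_zero]
      rw [mvfderiv_const]
      have : (fun z : P => (0 : TangentSpace 𝓘(ℝ, EP) z)) = 0 := rfl
      rw [this, VectorField.mlieBracket_zero_right]
      simp
    | insert i s hi ih =>
      have ss : ContMDiff 𝓘(ℝ, EP) 𝓘(ℝ, EK) ∞ fun z => ∑ i ∈ s, f i z • b i :=
        contMDiff_finsetSum fun i _ => smooth i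
      simp only [Finset.sum_insert hi, map_add]
      rw [mvfderiv_fun_add ((smooth i).mdifferentiableAt (by simp))
        (ss.mdifferentiableAt (by simp)), _root_.add_apply, map_add, ← ih, ← key _ _ (hf i)]
      exact VectorField.mlieBracket_add_right
        ((hp.contMDiffAt_fundamental (smooth i y)).mdifferentiableAt (by simp))
        ((hp.contMDiffAt_fundamental (ss y)).mdifferentiableAt (by simp))
  let b := Module.Basis.ofVectorSpace ℝ EK
  have e : (fun z => ∑ i, b.repr (ν z) i • b i) = ν := by
    ext z
    exact b.sum_repr (ν z)
  have h := sum Finset.univ (fun i z => b.repr (ν z) i) b fun i =>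
    ((LinearMap.toContinuousLinearMap (b.coord i)).contDiff.contMDiff).comp hν
  rw [e] at h
  rw [← h]
  simp only [b.sum_repr]

end Invariant

/-! ### The Lie derivative of the connection metric. -/

section Main

variable
    {EM : Type*} [NormedAddCommGroup EM] [NormedSpace ℝ EM]
    {M : Type*} [TopologicalSpace M] [ChartedSpace EM M]
    {EK : Type*} [NormedAddCommGroup EK] [NormedSpace ℝ EK]
    {K : Type*} [TopologicalSpace K] [ChartedSpace EK K] [Group K]
    {EP : Type*} [NormedAddCommGroup EP] [NormedSpace ℝ EP]
    {P : Type*} [TopologicalSpace P] [ChartedSpace EP P] [MulAction Kᵐᵒᵖ P]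
    {p : P → M}

section Invariance

variable [IsManifold 𝓘(ℝ, EP) ∞ P] [LieGroup 𝓘(ℝ, EK) ∞ K]
  (hp : IsPrincipalBundle EM EK EP K p)

include hp

/-- The vertical field of a section of the adjoint bundle is invariant. -/
theorem Connection.mfderiv_smul_verticalField (A : Connection EK EP K P)
    (ν : AdSection EK EP K P) (k : K) (y : P) :
    mfderiv 𝓘(ℝ, EP) 𝓘(ℝ, EP) (fun z : P => MulOpposite.op k • z) y (ν.verticalField y) =
      ν.verticalField (MulOpposite.op k • y) := by
  simp only [AdSection.verticalField]
  refine A.eq_of_proj_form_eq hp ?_ ?_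
  · rw [hp.mfderiv_proj_fundamental]
    refine (hp.mfderiv_proj_smul k y _).trans ?_
    rw [hp.mfderiv_proj_fundamental]
    rfl
  · rw [A.form_fundamental, A.form_act, A.form_fundamental, ν.equivariant]

variable [FiniteDimensional ℝ EP] {A : Connection EK EP K P}

/-- The horizontal lift is invariant. -/
theorem Connection.mfderiv_smul_lift (X : ∀ x : M, TangentSpace 𝓘(ℝ, EM) x) (k : K) (y : P) :
    mfderiv 𝓘(ℝ, EP) 𝓘(ℝ, EP) (fun z : P => MulOpposite.op k • z) y (A.lift p X y) =
      A.lift p X (MulOpposite.op k • y) := by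
  refine A.eq_of_proj_form_eq hp ?_ ?_
  · rw [A.mfderiv_proj_lift hp]
    refine (hp.mfderiv_proj_smul k y _).trans ?_
    rw [A.mfderiv_proj_lift hp]
    exact congrArg (fun x => (X x : EM)) (hp.proj_act y k).symm
  · rw [A.form_lift hp, A.form_act, A.form_lift hp, map_zero]

variable [IsManifold 𝓘(ℝ, EM) ∞ M]

/-- The horizontal lift of a smooth vector field, as a smooth vector field. -/
def Connection.smoothLift (A : Connection EK EP K P) (X : SmoothVF EM M) : SmoothVF EP P :=
  ⟨A.lift p X, A.contMDiff_lift hp X⟩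

theorem Connection.isInvariant_smoothLift (X : SmoothVF EM M) :
    IsInvariant K (A.smoothLift hp X) := fun k y => A.mfderiv_smul_lift hp X k y

end Invariance

theorem lieBr_zero : lieBr K (0 : EK) 0 = 0 := by
  refine (GroupLieAlgebra.bracket_def (I := 𝓘(ℝ, EK)) (G := K) 0 0).trans ?_
  rw [VectorField.mlieBracket_self]
  rfl

variable [IsManifold 𝓘(ℝ, EP) ∞ P] [IsManifold 𝓘(ℝ, EM) ∞ M]

/-- A Riemannian metric as a field of bilinear forms. -/
def riemannianForm (g : Bundle.ContMDiffRiemannianMetric 𝓘(ℝ, EM) ∞ EM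
      (fun x : M => TangentSpace 𝓘(ℝ, EM) x)) (x : M) :
    TangentSpace 𝓘(ℝ, EM) x →ₗ[ℝ] TangentSpace 𝓘(ℝ, EM) x →ₗ[ℝ] ℝ :=
  LinearMap.mk₂ ℝ (fun v w => g.inner x v w) (by simp) (by simp) (by simp) (by simp)

/-- The connection metric as a field of bilinear forms. -/
def Connection.metricForm (A : Connection EK EP K P) (p : P → M) (B : AdInvariantInner EK K)
    (g : Bundle.ContMDiffRiemannianMetric 𝓘(ℝ, EM) ∞ EM
      (fun x : M => TangentSpace 𝓘(ℝ, EM) x)) (y : P) :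
    TangentSpace 𝓘(ℝ, EP) y →ₗ[ℝ] TangentSpace 𝓘(ℝ, EP) y →ₗ[ℝ] ℝ :=
  LinearMap.mk₂ ℝ (A.metric p B g y)
    (by intros; simp only [Connection.metric, map_add, _root_.add_apply, LinearMap.add_apply]; ring)
    (by intros; simp only [Connection.metric, map_smul, _root_.smul_apply, smul_eq_mul,
          LinearMap.smul_apply]; ring)
    (by intros; simp only [Connection.metric, map_add]; ring)
    (by intros; simp only [Connection.metric, map_smul, smul_eq_mul]; ring)

variable (A : Connection EK EP K P) (B : AdInvariantInner EK K)
  (g : Bundle.ContMDiffRiemannianMetric 𝓘(ℝ, EM) ∞ EM (fun x : M => TangentSpace 𝓘(ℝ, EM) x))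

theorem Connection.metricForm_apply (y : P) (v w : TangentSpace 𝓘(ℝ, EP) y) :
    A.metricForm p B g y v w =
    g.inner (p y) (mfderiv 𝓘(ℝ, EP) 𝓘(ℝ, EM) p y v) (mfderiv 𝓘(ℝ, EP) 𝓘(ℝ, EM) p y w) +
      B.form (A.form y v) (A.form y w) := rfl

theorem contMDiff_riemannianForm (X₁ X₂ : SmoothVF EM M) :
    ContMDiff 𝓘(ℝ, EM) 𝓘(ℝ, ℝ) ∞ fun z => riemannianForm g z (X₁ z) (X₂ z) := by
  intro x
  have := ContMDiffAt.clm_bundle_apply₂ (F₁ := EM) (F₂ := EM) (F₃ := ℝ)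
    (E₃ := Bundle.Trivial M ℝ) (b := fun x : M => x) (g.contMDiff x) (X₁.contMDiff x)
    (X₂.contMDiff x)
  rw [contMDiffAt_totalSpace] at this
  exact this.2

variable [FiniteDimensional ℝ EK]

theorem AdInvariantInner.contDiff_form (B : AdInvariantInner EK K) :
    ContDiff ℝ ∞ fun q : EK × EK => B.form q.1 q.2 :=
  (LinearMap.toContinuousBilinearMap B.form).isBoundedBilinearMap.contDiff

theorem Connection.contMDiff_metricForm (hp : ContMDiff 𝓘(ℝ, EP) 𝓘(ℝ, EM) ∞ p)
    (X₁ X₂ : SmoothVF EP P) :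
    ContMDiff 𝓘(ℝ, EP) 𝓘(ℝ, ℝ) ∞ fun z => A.metricForm p B g z (X₁ z) (X₂ z) := by
  intro y
  have tp := hp.contMDiff_tangentMap (m := ∞) (by simp)
  have := ContMDiffAt.clm_bundle_apply₂ (F₁ := EM) (F₂ := EM) (F₃ := ℝ)
    (E₃ := Bundle.Trivial M ℝ) (b := p) ((g.contMDiff (p y)).comp y (hp y))
    ((tp _).comp y (X₁.contMDiff y)) ((tp _).comp y (X₂.contMDiff y))
  rw [contMDiffAt_totalSpace] at this
  exact this.2.add ((B.contDiff_form.contMDiff _).comp y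
    ((A.contMDiffAt_form_apply (X₁.contMDiff y)).prodMk_space
      (A.contMDiffAt_form_apply (X₂.contMDiff y))))

theorem Connection.mdifferentiableAt_metricForm (hp : ContMDiff 𝓘(ℝ, EP) 𝓘(ℝ, EM) ∞ p)
    {y : P} (X₁ X₂ : ∀ y : P, TangentSpace 𝓘(ℝ, EP) y)
    (h₁ : VFDiffAt 𝓘(ℝ, EP) X₁ y) (h₂ : VFDiffAt 𝓘(ℝ, EP) X₂ y) :
    MDifferentiableAt 𝓘(ℝ, EP) 𝓘(ℝ, ℝ) (fun z => A.metricForm p B g z (X₁ z) (X₂ z)) y := by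
  have tp := (hp.contMDiff_tangentMap (m := ∞) (by simp)).mdifferentiable (by simp)
  have := MDifferentiableAt.clm_bundle_apply₂ (F₁ := EM) (F₂ := EM) (F₃ := ℝ)
    (E₃ := Bundle.Trivial M ℝ) (b := p)
    ((g.contMDiff.mdifferentiable (by simp) (p y)).comp y (hp.mdifferentiable (by simp) y))
    ((tp _).comp y h₁) ((tp _).comp y h₂)
  rw [mdifferentiableAt_totalSpace] at this
  exact this.2.add ((B.contDiff_form.contMDiff.mdifferentiable (by simp) _).comp y
    ((A.mdifferentiableAt_form_apply h₁).prodMk_space (A.mdifferentiableAt_form_apply h₂)))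

variable {A} [LieGroup 𝓘(ℝ, EK) ∞ K] [FiniteDimensional ℝ EP]
  (hp : IsPrincipalBundle EM EK EP K p)

include hp

/-- The vertical field of a smooth map `P → 𝔨`, as a smooth vector field. -/
def IsPrincipalBundle.smoothVertical (ν : P → EK) (hν : ContMDiff 𝓘(ℝ, EP) 𝓘(ℝ, EK) ∞ ν) :
    SmoothVF EP P :=
  ⟨fun z => fundamental K z (ν z), fun y => hp.contMDiffAt_fundamental (hν y)⟩

/-- `-ω([Y, Z̃]) = F_A(X, Z) + ∇_Z ν` for `Y = X̃ + ξ^ν`. -/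
theorem Connection.form_mlieBracket_lift {X : SmoothVF EM M} (ν : AdSection EK EP K P)
    {Y : SmoothVF EP P} (hY : ∀ y, Y y = A.lift p X y + ν.verticalField y)
    (Z : SmoothVF EM M) (y : P) :
    A.form y (VectorField.mlieBracket 𝓘(ℝ, EP) Y (A.lift p Z) y) =
      -(A.curvature p X Z y + A.covDeriv p Z ν y) := by
  have : CompleteSpace EP := FiniteDimensional.complete ℝ EP
  have hYe : Y = A.smoothLift hp X + hp.smoothVertical ν.toFun ν.contMDiff_toFun := by
    ext y; exact hY y
  -- The invariant field in the vertical bracket formula is `Z̃`, so `[ξ^ν, Z̃]` is first swapped,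
  -- whence the minus sign.
  have h1 : VectorField.mlieBracket 𝓘(ℝ, EP) Y (A.lift p Z) y =
      VectorField.mlieBracket 𝓘(ℝ, EP) (A.lift p X) (A.lift p Z) y -
        fundamental K y (mvfderiv 𝓘(ℝ, EP) ν.toFun y (A.lift p Z y)) := by
    have hv := hp.mlieBracket_vertical (A.isInvariant_smoothLift hp Z) ν.contMDiff_toFun y
    refine Eq.trans ?_
      (congrArg (VectorField.mlieBracket 𝓘(ℝ, EP) (A.lift p X) (A.lift p Z) y - ·) hv)
    rw [hYe]
    refine (VectorField.mlieBracket_add_left ((A.smoothLift hp X).vfDiffAt y)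
      ((hp.smoothVertical ν.toFun ν.contMDiff_toFun).vfDiffAt y)).trans ?_
    rw [sub_eq_add_neg, ← VectorField.mlieBracket_swap_apply]
    rfl
  -- Horizontality leaves only `-ω([X̃, Z̃])` in the curvature.
  have z : ∀ W : SmoothVF EM M, (fun z => A.form z (A.lift p W z)) = fun _ => 0 := fun W =>
    funext fun z => A.form_lift hp W z
  rw [h1, map_sub, A.form_fundamental, Connection.curvature, Connection.curvatureForm, z, z,
    Connection.dirDeriv, Connection.dirDeriv, mfderiv_const, A.form_lift hp, A.form_lift hp,
    lieBr_zero, Connection.covDeriv, Connection.dirDeriv]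
  change _ = -((0 : EK) - (0 : EK) - _ + 0 + mvfderiv 𝓘(ℝ, EP) ν.toFun y (A.lift p Z y))
  rw [sub_zero, zero_sub, add_zero]
  abel

/-- The Lie derivative of the connection metric along `Y = X̃ + ξ^ν`. -/
theorem Connection.lieDerivative_metricForm [FiniteDimensional ℝ EM] {X : SmoothVF EM M}
    (ν : AdSection EK EP K P) {Y : SmoothVF EP P}
    (hY : ∀ y, Y y = A.lift p X y + ν.verticalField y) (Z₁ Z₂ : SmoothVF EM M) (a₁ a₂ : EK)
    (y : P) :
    lieDerivative (A.metricForm p B g) Y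
      (A.smoothLift hp Z₁ + hp.smoothVertical (fun _ => a₁) contMDiff_const : SmoothVF EP P)
      (A.smoothLift hp Z₂ + hp.smoothVertical (fun _ => a₂) contMDiff_const : SmoothVF EP P) y =
    lieDerivative (riemannianForm g) X Z₁ Z₂ (p y) +
      B.form (A.curvature p X Z₁ y + A.covDeriv p Z₁ ν y) a₂ +
      B.form a₁ (A.curvature p X Z₂ y + A.covDeriv p Z₂ ν y) := by
  have : CompleteSpace EP := FiniteDimensional.complete ℝ EP
  let S : SmoothVF EM M → EK → SmoothVF EP P := fun Z a =>
    A.smoothLift hp Z + hp.smoothVertical (fun _ => a) contMDiff_const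
  have S_apply : ∀ Z a y, S Z a y = A.lift p Z y + fundamental K y a := fun Z a y => rfl
  have S_proj : ∀ Z a y, mfderiv 𝓘(ℝ, EP) 𝓘(ℝ, EM) p y (S Z a y) = Z (p y) := by
    intro Z a y
    rw [S_apply, map_add, A.mfderiv_proj_lift hp, hp.mfderiv_proj_fundamental, add_zero]
  have S_form : ∀ Z a y, A.form y (S Z a y) = a := by
    intro Z a y
    rw [S_apply, map_add, A.form_lift hp, A.form_fundamental, zero_add]
  have Y_proj : ∀ y, mfderiv 𝓘(ℝ, EP) 𝓘(ℝ, EM) p y (Y y) = X (p y) := by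
    intro y
    rw [hY, map_add, A.mfderiv_proj_lift hp, AdSection.verticalField, hp.mfderiv_proj_fundamental,
      add_zero]
  have Y_inv : IsInvariant K Y := by
    intro k y
    rw [hY, hY, map_add, A.mfderiv_smul_lift hp, A.mfderiv_smul_verticalField hp]
  have br_proj : ∀ Z a, mfderiv 𝓘(ℝ, EP) 𝓘(ℝ, EM) p y
      (VectorField.mlieBracket 𝓘(ℝ, EP) Y (S Z a) y) =
      VectorField.mlieBracket 𝓘(ℝ, EM) X Z (p y) := fun Z a =>
    mfderiv_mlieBracket_of_related ((hp.contMDiff_proj y).of_le ENat.LEInfty.out) (Y.vfDiffAt y)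
      ((S Z a).vfDiffAt y) (X.vfDiffAt _) (Z.vfDiffAt _) (Eventually.of_forall Y_proj)
      (Eventually.of_forall (S_proj Z a))
  have br_form : ∀ Z a, A.form y (VectorField.mlieBracket 𝓘(ℝ, EP) Y (S Z a) y) =
      -(A.curvature p X Z y + A.covDeriv p Z ν y) := by
    intro Z a
    rw [← A.form_mlieBracket_lift hp ν hY Z y]
    have h := VectorField.mlieBracket_add_right (V := Y) ((A.smoothLift hp Z).vfDiffAt y)
      ((hp.smoothVertical (fun _ => a) contMDiff_const).vfDiffAt y)
    have h2 := hp.mlieBracket_fundamental Y_inv a y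
    refine congrArg (A.form y) (h.trans ?_)
    refine (congrArg (_ + ·) h2).trans (add_zero _)
  -- On the test fields the vertical part of the metric is constant, so only the function pulled
  -- back from `M` gets differentiated.
  have fn : (fun z => A.metricForm p B g z (S Z₁ a₁ z) (S Z₂ a₂ z)) =
      (fun x => riemannianForm g x (Z₁ x) (Z₂ x)) ∘ p + fun _ => B.form a₁ a₂ := by
    ext z
    rw [A.metricForm_apply, S_proj, S_proj, S_form, S_form]
    rfl
  have dg := (contMDiff_riemannianForm g Z₁ Z₂).mdifferentiableAt (x := p y) (by simp)
  have dp := hp.contMDiff_proj.mdifferentiableAt (x := y) (by simp)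
  change lieDerivative (A.metricForm p B g) Y (S Z₁ a₁) (S Z₂ a₂) y = _
  rw [lieDerivative, lieDerivative, fn, mvfderiv_add (dg.comp y dp) mdifferentiableAt_const,
    mvfderiv_const, add_zero, mvfderiv_comp_apply_vector dg dp, Y_proj, A.metricForm_apply,
    A.metricForm_apply, S_proj, S_proj, S_form, S_form, br_proj, br_proj, br_form, br_form,
    map_neg, map_neg, LinearMap.neg_apply]
  change _ - (riemannianForm g (p y) _ _ + _ + (riemannianForm g (p y) _ _ + _)) = _
  ring

end Main

/-! ### Decomposition and brackets of invariant vector fields. -/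

section Final

variable
    {EM : Type*} [NormedAddCommGroup EM] [NormedSpace ℝ EM]
    {M : Type*} [TopologicalSpace M] [ChartedSpace EM M]
    {EK : Type*} [NormedAddCommGroup EK] [NormedSpace ℝ EK]
    {K : Type*} [TopologicalSpace K] [ChartedSpace EK K] [Group K]
    {EP : Type*} [NormedAddCommGroup EP] [NormedSpace ℝ EP]
    {P : Type*} [TopologicalSpace P] [ChartedSpace EP P] [MulAction Kᵐᵒᵖ P]
    {p : P → M} [IsManifold 𝓘(ℝ, EP) ∞ P]
    (hp : IsPrincipalBundle EM EK EP K p)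

/-- The `𝔨`-component of an invariant vector field, as a section of the adjoint bundle. -/
def Connection.verticalPart (A : Connection EK EP K P) (Y : SmoothVF EP P) (hY : IsInvariant K Y) :
    AdSection EK EP K P where
  toFun y := A.form y (Y y)
  contMDiff_toFun y := A.contMDiffAt_form_apply (Y.contMDiff y)
  equivariant y k := by rw [← hY, A.form_act]

include hp

/-- An invariant vector field on a principal bundle is projectable. -/
theorem IsPrincipalBundle.exists_pushforward [IsManifold 𝓘(ℝ, EM) ∞ M] (Y : SmoothVF EP P)
    (hY : IsInvariant K Y) :
    ∃ X : SmoothVF EM M, ∀ y, mfderiv 𝓘(ℝ, EP) 𝓘(ℝ, EM) p y (Y y) = X (p y) := by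
  -- `σ` is an arbitrary choice of preimages. By `hX` the field `X` does not depend on it, so
  -- smoothness can be read off from a smooth local section instead.
  choose σ hσ using hp.surjective
  let X : ∀ x : M, TangentSpace 𝓘(ℝ, EM) x := fun x =>
    (mfderiv 𝓘(ℝ, EP) 𝓘(ℝ, EM) p (σ x) (Y (σ x)) : EM)
  have hX : ∀ (y : P) (x : M), p y = x →
      (mfderiv 𝓘(ℝ, EP) 𝓘(ℝ, EM) p y (Y y) : EM) = X x := by
    rintro y x rfl
    obtain ⟨k, hk⟩ := hp.exists_smul_eq (y := y) (y' := σ (p y)) (hσ _).symm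
    have h := hp.mfderiv_proj_smul k y (Y y)
    rw [hY k y, hk] at h
    exact h.symm
  refine ⟨⟨X, fun x => ?_⟩, fun y => hX y _ rfl⟩
  obtain ⟨U, s, κ, hU, hx, hs, hps, hκ, hh⟩ := hp.exists_local_section x
  have h1 := (hp.contMDiff_proj.contMDiff_tangentMap (m := ∞) (by simp)).contMDiffAt.comp x
    ((Y.contMDiff (s x)).comp x (hs.contMDiffAt (hU.mem_nhds hx)))
  refine h1.congr_of_eventuallyEq ?_
  filter_upwards [hU.mem_nhds hx] with z hz
  exact Bundle.TotalSpace.ext (hps z hz).symm (heq_of_eq (hX (s z) z (hps z hz)).symm)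

/-- The horizontal and vertical components of an invariant vector field. -/
theorem Connection.eq_lift_add_vertical [FiniteDimensional ℝ EP] [LieGroup 𝓘(ℝ, EK) ∞ K]
    (A : Connection EK EP K P) {Y : SmoothVF EP P} (hY : IsInvariant K Y)
    {X : ∀ x : M, TangentSpace 𝓘(ℝ, EM) x}
    (hX : ∀ y, mfderiv 𝓘(ℝ, EP) 𝓘(ℝ, EM) p y (Y y) = X (p y)) (y : P) :
    Y y = A.lift p X y + (A.verticalPart Y hY).verticalField y := by
  refine A.eq_of_proj_form_eq hp ?_ ?_
  · rw [map_add, A.mfderiv_proj_lift hp, AdSection.verticalField, hp.mfderiv_proj_fundamental,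
      add_zero, hX]
  · rw [map_add, A.form_lift hp, AdSection.verticalField, A.form_fundamental, zero_add]
    rfl

/-- The bracket of invariant vector fields is invariant. -/
theorem IsPrincipalBundle.isInvariant_bracket [FiniteDimensional ℝ EP] {Y Z : SmoothVF EP P}
    (hY : IsInvariant K Y)
    (hZ : IsInvariant K Z) : IsInvariant K ⁅Y, Z⁆ := fun k y =>
  mfderiv_mlieBracket_of_related (((hp.contMDiff_smul k) y).of_le ENat.LEInfty.out)
    (Y.vfDiffAt y) (Z.vfDiffAt y) (Y.vfDiffAt _) (Z.vfDiffAt _)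
    (Eventually.of_forall (hY k)) (Eventually.of_forall (hZ k))

end Final

/-! ### The Killing criterion for `X̃ + ξ^ν`. -/

section Killing

variable
    {EM : Type*} [NormedAddCommGroup EM] [NormedSpace ℝ EM] [FiniteDimensional ℝ EM]
    {M : Type*} [TopologicalSpace M] [T2Space M] [SecondCountableTopology M]
    [ChartedSpace EM M] [IsManifold 𝓘(ℝ, EM) ∞ M]
    {EK : Type*} [NormedAddCommGroup EK] [NormedSpace ℝ EK] [FiniteDimensional ℝ EK]
    {K : Type*} [TopologicalSpace K] [ChartedSpace EK K] [Group K] [LieGroup 𝓘(ℝ, EK) ∞ K]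
    {EP : Type*} [NormedAddCommGroup EP] [NormedSpace ℝ EP] [FiniteDimensional ℝ EP]
    {P : Type*} [TopologicalSpace P] [ChartedSpace EP P] [IsManifold 𝓘(ℝ, EP) ∞ P]
    [MulAction Kᵐᵒᵖ P]
    {p : P → M} (hp : IsPrincipalBundle EM EK EP K p)
    (A : Connection EK EP K P) (B : AdInvariantInner EK K)
    (g : Bundle.ContMDiffRiemannianMetric 𝓘(ℝ, EM) ∞ EM (fun x : M => TangentSpace 𝓘(ℝ, EM) x))

include hp

/-- `X̃ + ξ^ν` is Killing for the connection metric if and only if `X` is Killing and the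
moment map equation holds. -/
theorem Connection.isKilling_metric_iff {X : SmoothVF EM M} {ν : AdSection EK EP K P}
    {Y : SmoothVF EP P} (hY : ∀ y, Y y = A.lift p X y + ν.verticalField y) :
    IsKilling (A.metric p B g) Y ↔
      IsKilling (fun x v w => g.inner x v w) X ∧ A.MomentMapEq p X ν := by
  have main := A.lieDerivative_metricForm B g hp ν hY
  change IsKilling (fun y v w => A.metricForm p B g y v w) Y ↔
    IsKilling (fun x v w => riemannianForm g x v w) X ∧ _
  rw [isKilling_iff, isKilling_iff]
  constructor
  · intro h
    have hX : ∀ (Z₁ Z₂ : SmoothVF EM M) (x : M),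
        lieDerivative (riemannianForm g) X Z₁ Z₂ x = 0 := by
      intro Z₁ Z₂ x
      obtain ⟨y, rfl⟩ := hp.surjective x
      -- Purely horizontal test fields isolate `L_X g`.
      have := main Z₁ Z₂ 0 0 y
      rw [h, map_zero, map_zero, LinearMap.zero_apply, add_zero, add_zero] at this
      exact this.symm
    refine ⟨hX, fun Z y => ?_⟩
    -- Pairing the defect of the moment map equation with itself lets positivity force it to vanish.
    have := main Z Z 0 (A.curvature p X Z y + A.covDeriv p Z ν y) y
    rw [h, hX, map_zero, LinearMap.zero_apply, add_zero, zero_add] at this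
    by_contra hne
    exact (B.pos _ fun h0 => hne (eq_neg_of_add_eq_zero_left h0)).ne this
  · rintro ⟨hX, hν⟩ Y₁ Y₂ y
    -- Every tangent vector at `y` is the value of a test field, which by tensoriality may replace
    -- the given field.
    have ext : ∀ W : SmoothVF EP P, ∃ (Z : SmoothVF EM M) (a : EK),
        W y = (A.smoothLift hp Z + hp.smoothVertical (fun _ => a) contMDiff_const :
          SmoothVF EP P) y := by
      intro W
      obtain ⟨Z, hZ⟩ := exists_smoothVF_apply_eq (p y) (mfderiv 𝓘(ℝ, EP) 𝓘(ℝ, EM) p y (W y))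
      refine ⟨Z, A.form y (W y), ?_⟩
      change _ = A.lift p Z y + fundamental K y (A.form y (W y))
      refine A.eq_of_proj_form_eq hp ?_ ?_
      · rw [map_add, A.mfderiv_proj_lift hp, hp.mfderiv_proj_fundamental, add_zero, hZ]
      · rw [map_add, A.form_lift hp, A.form_fundamental, zero_add]
    obtain ⟨Z₁, a₁, h₁⟩ := ext Y₁
    obtain ⟨Z₂, a₂, h₂⟩ := ext Y₂
    rw [lieDerivative_pointwise (A.mdifferentiableAt_metricForm B g hp.contMDiff_proj) Y
      (Y₁.vfDiffAt y) (SmoothVF.vfDiffAt _ y) (Y₂.vfDiffAt y) (SmoothVF.vfDiffAt _ y) h₁ h₂,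
      main, hX, hν, hν]
    simp

end Killing
end ConnectionMetric
end

/-! ### The Lie algebras of Killing and of invariant Killing fields. -/

theorem mainTheorem5
    {EM : Type*} [NormedAddCommGroup EM] [NormedSpace ℝ EM] [FiniteDimensional ℝ EM]
    {M : Type*} [TopologicalSpace M] [T2Space M] [SecondCountableTopology M]
    [ChartedSpace EM M] [IsManifold 𝓘(ℝ, EM) ∞ M]
    {EK : Type*} [NormedAddCommGroup EK] [NormedSpace ℝ EK] [FiniteDimensional ℝ EK]
    {K : Type*} [TopologicalSpace K] [T2Space K] [CompactSpace K]
    [ChartedSpace EK K] [Group K] [LieGroup 𝓘(ℝ, EK) ∞ K]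
    {EP : Type*} [NormedAddCommGroup EP] [NormedSpace ℝ EP] [FiniteDimensional ℝ EP]
    {P : Type*} [TopologicalSpace P] [T2Space P] [SecondCountableTopology P]
    [ChartedSpace EP P] [IsManifold 𝓘(ℝ, EP) ∞ P] [MulAction Kᵐᵒᵖ P]
    (p : P → M) (hp : ConnectionMetric.IsPrincipalBundle EM EK EP K p)
    (A : ConnectionMetric.Connection EK EP K P)
    (B : ConnectionMetric.AdInvariantInner EK K)
    (g : Bundle.ContMDiffRiemannianMetric 𝓘(ℝ, EM) ∞ EM
      (fun x : M => TangentSpace 𝓘(ℝ, EM) x)) :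
    ∃ iP iK : LieSubalgebra ℝ (ConnectionMetric.SmoothVF EP P),
      (∀ Y, Y ∈ iP ↔ ConnectionMetric.IsKilling (A.metric p B g) Y) ∧
      (∀ Y, Y ∈ iK ↔
        ConnectionMetric.IsKilling (A.metric p B g) Y ∧ ConnectionMetric.IsInvariant K Y) ∧
      iK ≤ iP ∧
      (fun Y : ConnectionMetric.SmoothVF EP P => (Y : ∀ y : P, TangentSpace 𝓘(ℝ, EP) y)) '' iK =
        {W | ∃ (X : ConnectionMetric.SmoothVF EM M) (ν : ConnectionMetric.AdSection EK EP K P),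
          ConnectionMetric.IsKilling (fun x v w => g.inner x v w) X ∧
          A.MomentMapEq p X ν ∧
          W = A.lift p X + ν.verticalField} := by
  let iP := ConnectionMetric.killingAlgebra (A.metricForm p B g)
    (A.contMDiff_metricForm B g hp.contMDiff_proj)
  let inv : LieSubalgebra ℝ (ConnectionMetric.SmoothVF EP P) :=
    { carrier := {Y | ConnectionMetric.IsInvariant K Y}
      zero_mem' := fun k y => map_zero (mfderiv 𝓘(ℝ, EP) 𝓘(ℝ, EP) _ y)
      add_mem' := fun {Y Z} hY hZ k y =>
        (map_add (mfderiv 𝓘(ℝ, EP) 𝓘(ℝ, EP) _ y) (Y y) (Z y)).trans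
          (congrArg₂ (· + ·) (hY k y) (hZ k y))
      smul_mem' := fun c Y hY k y =>
        (map_smul (mfderiv 𝓘(ℝ, EP) 𝓘(ℝ, EP) _ y) c (Y y)).trans
          (congrArg (c • ·) (hY k y))
      lie_mem' := hp.isInvariant_bracket }
  refine ⟨iP, iP ⊓ inv, fun Y => Iff.rfl, fun Y => Iff.rfl, inf_le_left, Set.ext fun W => ?_⟩
  constructor
  · rintro ⟨Y, ⟨hY, hinv⟩, rfl⟩
    obtain ⟨X, hX⟩ := hp.exists_pushforward Y hinv
    have hdec := A.eq_lift_add_vertical hp hinv hX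
    obtain ⟨h1, h2⟩ := (A.isKilling_metric_iff hp B g hdec).1 hY
    exact ⟨X, A.verticalPart Y hinv, h1, h2, funext hdec⟩
  · rintro ⟨X, ν, hX, hν, rfl⟩
    refine ⟨A.smoothLift hp X + hp.smoothVertical ν.toFun ν.contMDiff_toFun, ⟨?_, ?_⟩, rfl⟩
    · exact (A.isKilling_metric_iff hp B g fun y => rfl).2 ⟨hX, hν⟩
    · intro k y
      refine (map_add (mfderiv 𝓘(ℝ, EP) 𝓘(ℝ, EP) _ y) (A.lift p X y) (ν.verticalField y)).trans ?_
      exact congrArg₂ (· + ·) (A.mfderiv_smul_lift hp X k y) (A.mfderiv_smul_verticalField hp ν k y)
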